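/- Setting. Let $d\ge 1$, $\|\cdot\|$ the maximum norm on $\mathbb Z^d$, and $B_L(x)=\{y\in\mathbb Z^d:\|y-x\|\le L\}$. Let $\gamma>0$, $\rho>1$, $\varepsilon>0$, and let $\phi:\mathbb Z^d\to\mathbb C$ satisfy $\phi(x-y)=\overline{\phi(y-x)}$ and $|\phi(x)|\le e^{-\gamma\log^\rho(\|x\|+1)}$. Let $\{V_\omega(x)\}_{x\in\mathbb Z^d}$ be i.i.d. real random variables on a probability space $(\Omega,\mathcal F,\mathbb P)$, and let $H_\omega(x,y)=\varepsilon\phi(x-y)+V_\omega(x)\delta_{x,y}$. For a finite $B\subset\mathbb Z^d$ let $H_B$ be the restriction of $H_\omega$ to $B$, and for $E\notin\sigma(H_B)$ let $\mathcal G_B^E=(H_B-E)^{-1}$. Let $1<\rho'<\rho$. The cube $B_L(x)$ is $E$-NR if $\mathrm{dist}(E,\sigma(H_{B_L(x)}))\ge e^{-\log^{\rho'}L}$, and $E$-R otherwise. It is $(\kappa,E)$-good if it is $E$-NR and $|\mathcal G^E_{B_L(x)}(x,y)|\le e^{-\kappa\log^\rho(\|x-y\|+1)}$ for all $y\in B_L(x)$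 with $\|y-x\|>L^{4/5}$, and $(\kappa,E)$-bad otherwise. For $l\in\mathbb N$ put $$m(l)=\gamma\frac{11}{\log^{\rho-1}l}+\gamma\frac{11}{l^{\frac45\alpha-1}}+\frac{31+2^\rho}{\log^{\rho-\rho'}l}.$$ Theorem. Let $d\ge1$, $1<\rho'<\rho$, $p>5d$, $\alpha\in\left(\frac45,\frac{2p}{p+2d}\right)$, $\kappa>0$ and $\varepsilon_1>0$. There is $\underline l_0=\underline l_0(\rho,\rho',p,d,\alpha,\kappa,\varepsilon_1)>0$, and for every $\gamma>0$ there is $\underline l_1=\underline l_1(\rho,\rho',p,d,\alpha,\kappa,\varepsilon_1,\gamma)>0$, such that the following holds for all $\kappa_0$ with $\kappa\le\kappa_0\le\gamma/5$, all $\phi$, $V_\omega$ as above, all $0<\varepsilon\le\varepsilon_1$, all $I\subset\mathbb R$, and all $l\in\mathbb N$ with $l\ge\underline l_0$, where $L=[l^\alpha]$. Suppose that $m(l)\le\kappa$ and that (P1) $\mathbb P\{\exists E\in I:\ B_l(x)\text{ and }B_l(y)\text{ are both }(\kappa,E)\text{-bad}\}\le l^{-2p}$ for all $\|x-y\|>2l$;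 (P2) $\mathbb P\left\{\bigcup_{E\in I}(\mathbf D_x(E)\cap\mathbf D_y(E))\right\}\le\frac14L^{-2p}$ for all $\|x-y\|>2L$, where $\mathbf D_x(E)$ is the event that $B_L(x)$, or one of $B_{2l}(z),B_{8l}(z),B_{26l}(z)$ for some $z\in B_L(x)$, is $E$-R. Then, with $$\kappa'=\kappa-\left(\gamma\frac{10}{l^{\frac45\alpha-1}}+\gamma\frac{10}{\log^{\rho-1}l}+\frac{30+2^\rho}{\log^{\rho-\rho'}l}\right),$$ we have $$\mathbb P\{\exists E\in I:\ B_L(x)\text{ and }B_L(y)\text{ are both }(\kappa',E)\text{-bad}\}\le L^{-2p}\quad\text{for all }\|x-y\|>2L,$$ and $0<\kappa'<\kappa\le\kappa_0$. If moreover $l\ge\underline l_1$, then $m(L)\le\kappa'$. -/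

import Mathlib

namespace MSA

/-- The cube `B_L(x) = {y ∈ ℤ^d : ‖y - x‖ ≤ L}`; see `mem_cube`. The norm on `Fin d → ℤ` is the
maximum norm. -/
noncomputable def cube {d : ℕ} (L : ℕ) (x : Fin d → ℤ) : Finset (Fin d → ℤ) :=
  Finset.Icc (fun i => x i - (L : ℤ)) (fun i => x i + (L : ℤ))

theorem mem_cube {d : ℕ} (L : ℕ) (x y : Fin d → ℤ) :
    y ∈ cube L x ↔ ‖y - x‖ ≤ (L : ℝ) := by
  rw [pi_norm_le_iff_of_nonneg (Nat.cast_nonneg L)]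
  simp only [cube, Finset.mem_Icc, Pi.le_def, Pi.sub_apply, Int.norm_eq_abs]
  rw [← forall_and]
  refine forall_congr' fun i => ?_
  have h : (|((y i - x i : ℤ) : ℝ)| ≤ (L : ℝ)) ↔ |y i - x i| ≤ (L : ℤ) := by
    rw [← Int.cast_abs]
    exact_mod_cast Iff.rfl
  rw [h, abs_le]
  constructor <;> rintro ⟨h1, h2⟩ <;> constructor <;> linarith

theorem self_mem_cube {d : ℕ} (L : ℕ) (x : Fin d → ℤ) : x ∈ cube L x := by
  simp [mem_cube]

/-- `Γ_φ(x, y) = φ(x - y)` is a Hermitian hopping term with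
`|φ(x)| ≤ exp (-γ log^ρ (‖x‖ + 1))`. -/
structure IsHopping {d : ℕ} (γ ρ : ℝ) (φ : (Fin d → ℤ) → ℂ) : Prop where
  hermitian : ∀ x y : Fin d → ℤ, φ (x - y) = star (φ (y - x))
  decay : ∀ x : Fin d → ℤ, ‖φ x‖ ≤ Real.exp (-γ * Real.log (‖x‖ + 1) ^ ρ)

/-- The matrix element `H(x, y) = ε φ(x - y) + v(x) δ_{x,y}` of the operator with potential `v`. -/
noncomputable def kernel {d : ℕ} (ε : ℝ) (φ : (Fin d → ℤ) → ℂ) (v : (Fin d → ℤ) → ℝ)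
    (x y : Fin d → ℤ) : ℂ :=
  (ε : ℂ) * φ (x - y) + if x = y then (v x : ℂ) else 0

/-- The restriction `H_B = R_B H R_B` to a finite set `B`, as a matrix acting on `ℓ²(B)`. -/
noncomputable def restrict {d : ℕ} (ε : ℝ) (φ : (Fin d → ℤ) → ℂ) (v : (Fin d → ℤ) → ℝ)
    (B : Finset (Fin d → ℤ)) : Matrix B B ℂ :=
  Matrix.of fun x y => kernel ε φ v x y

/-- The Green's function `(H_B - E)⁻¹`; meaningful for `E ∉ σ(H_B)`, and only used there. -/
noncomputable def green {d : ℕ} (ε : ℝ) (φ : (Fin d → ℤ) → ℂ) (v : (Fin d → ℤ) → ℝ)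
    (B : Finset (Fin d → ℤ)) (E : ℝ) : Matrix B B ℂ :=
  (restrict ε φ v B - (E : ℂ) • (1 : Matrix B B ℂ))⁻¹

/-- `B_L(x)` is non-resonant at `E`: `dist (E, σ(H_{B_L(x)})) ≥ exp (-log^ρ' L)`. -/
def IsNR {d : ℕ} (ρ' ε : ℝ) (φ : (Fin d → ℤ) → ℂ) (v : (Fin d → ℤ) → ℝ)
    (E : ℝ) (L : ℕ) (x : Fin d → ℤ) : Prop :=
  Real.exp (-(Real.log L ^ ρ')) ≤
    Metric.infDist (E : ℂ) (spectrum ℂ (restrict ε φ v (cube L x)))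

/-- `B_L(x)` is `(κ, E)`-good: it is non-resonant at `E` and
`|G(x, y)| ≤ exp (-κ log^ρ (‖x - y‖ + 1))` for all `y ∈ B_L(x)` with `‖y - x‖ > L^{4/5}`. -/
def IsGood {d : ℕ} (ρ ρ' ε : ℝ) (φ : (Fin d → ℤ) → ℂ) (v : (Fin d → ℤ) → ℝ)
    (κ E : ℝ) (L : ℕ) (x : Fin d → ℤ) : Prop :=
  IsNR ρ' ε φ v E L x ∧
    ∀ y : cube L x, (L : ℝ) ^ (4 / 5 : ℝ) < ‖(y : Fin d → ℤ) - x‖ →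
      ‖green ε φ v (cube L x) E ⟨x, self_mem_cube L x⟩ y‖ ≤
        Real.exp (-κ * Real.log (‖x - (y : Fin d → ℤ)‖ + 1) ^ ρ)

/-- The event `D_x(E)`: `B_L(x)`, or one of `B_{2l}(z)`, `B_{8l}(z)`, `B_{26l}(z)` with
`z ∈ B_L(x)`, is resonant at `E`. -/
def HasResonance {d : ℕ} (ρ' ε : ℝ) (φ : (Fin d → ℤ) → ℂ) (v : (Fin d → ℤ) → ℝ)
    (l L : ℕ) (E : ℝ) (x : Fin d → ℤ) : Prop :=
  ¬ IsNR ρ' ε φ v E L x ∨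
    ∃ z ∈ cube L x, ¬ IsNR ρ' ε φ v E (2 * l) z ∨ ¬ IsNR ρ' ε φ v E (8 * l) z ∨
      ¬ IsNR ρ' ε φ v E (26 * l) z

/-- The lower bound required of the decay rate at scale `l`. -/
noncomputable def minRate (γ ρ ρ' α : ℝ) (l : ℕ) : ℝ :=
  γ * (11 / Real.log l ^ (ρ - 1)) + γ * (11 / (l : ℝ) ^ (4 / 5 * α - 1)) +
    (31 + 2 ^ ρ) / Real.log l ^ (ρ - ρ')

/-- The decay rate `κ'` at the next scale. -/
noncomputable def nextRate (γ ρ ρ' α κ : ℝ) (l : ℕ) : ℝ :=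
  κ - (γ * (10 / (l : ℝ) ^ (4 / 5 * α - 1)) + γ * (10 / Real.log l ^ (ρ - 1)) +
    (30 + 2 ^ ρ) / Real.log l ^ (ρ - ρ'))

end MSA

/-! Suppose the `L`-cubes at `x` and `y` are both bad at the same `E ∈ I`. Either both have a
resonance, which (P2) bounds by `L^{-2p}/4`, or one of them is bad without a resonance. By the
deterministic `isGood_of_few_bad`, such a cube contains the centres of four `l`-cubes, bad at the
same `E`, pairwise more than `2l` apart. They form two pairs living on disjoint sets of sites, so
(P1) and independence give at most `|B_L|^4 l^{-4p} ≤ (3/8) L^{-2p}`, since `α < 2p/(p+2d)`. Finally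
`1/4 + 3/8 + 3/8 = 1`.

For the deterministic part, without four such centres the bad ones lie in at most three non-resonant
boxes of radius `2l`, `8l` or `26l`, at mutual distance at least `l` (`exists_separated_cover`).
Instead of iterating the resolvent identity, one maximises `|G(u,y)| e^{w(u)}` over `u`
(`norm_greenExt_center_le`). The weight `w` is nearly `κ log^ρ` of the number of radii left to cross
on the way from `x` to `y`; radii in the shells swept by the boxes are not counted, so crossing a
box is free. A penalty on boxes pays for their crude Green's function bound. One resolvent step,
through a good `l`-cube or a box, bounds the value at `u` by half the maximum unless no radii are
left, where non-resonance of the `L`-cube suffices. At `u = x` this gives decay in `‖x-y‖ - 250l` at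
a slightly smaller rate, and the losses fit into `κ - κ'`.

Subadditivity of the decay function comes from replacing `log^ρ (t+1)` by `log^ρ (t+e^ρ)`.
Measurability of events with `∃ E ∈ I`, for arbitrary `I`, holds because they are open in the
potential. -/

namespace MSA

/-! ### Hermitian matrices and their resolvents -/

section Matrix

variable {n : Type*} [Fintype n] [DecidableEq n]

/-- Expansion in an eigenbasis. The form with `ψ` serves twice: it bounds resolvent entries, and for
each fixed `ψ` it is a closed condition on the matrix. -/
theorem le_infDist_spectrum_iff [Nonempty n] {A : Matrix n n ℂ} (hA : A.IsHermitian) (E δ : ℝ) :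
    δ ≤ Metric.infDist (E : ℂ) (spectrum ℂ A) ↔
      ∀ ψ : n → ℂ, δ * ‖WithLp.toLp 2 ψ‖ ≤
        ‖WithLp.toLp 2 ((A - (E : ℂ) • (1 : Matrix n n ℂ)).mulVec ψ)‖ := by
  have hlow : ∀ ψ : n → ℂ, (A - (E : ℂ) • (1 : Matrix n n ℂ)).mulVec ψ =
      A.mulVec ψ - (E : ℂ) • ψ := by
    intro ψ
    rw [Matrix.sub_mulVec, Matrix.smul_mulVec, Matrix.one_mulVec]
  constructor
  · intro h ψ
    rcases le_or_gt δ 0 with hδ | hδ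
    · exact (mul_nonpos_of_nonpos_of_nonneg hδ (norm_nonneg _)).trans (norm_nonneg _)
    set b := hA.eigenvectorBasis with hb
    have hinner : ∀ i, inner ℂ (b i)
        (WithLp.toLp 2 ((A - (E : ℂ) • (1 : Matrix n n ℂ)).mulVec ψ)) =
        ((hA.eigenvalues i : ℂ) - E) * inner ℂ (b i) (WithLp.toLp 2 ψ) := by
      intro i
      have h1 : inner ℂ (b i) (WithLp.toLp 2 (A.mulVec ψ)) =
          (hA.eigenvalues i : ℂ) * inner ℂ (b i) (WithLp.toLp 2 ψ) := by
        have h2 := hA.mulVec_eigenvectorBasis i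
        have h3 : inner ℂ (b i) (WithLp.toLp 2 (A.mulVec ψ)) =
            inner ℂ (WithLp.toLp 2 (A.mulVec (b i).ofLp)) (WithLp.toLp 2 ψ) := by
          rw [EuclideanSpace.inner_eq_star_dotProduct, EuclideanSpace.inner_eq_star_dotProduct]
          simp only
          rw [Matrix.star_mulVec, hA.eq, dotProduct_comm, Matrix.dotProduct_mulVec,
            dotProduct_comm]
        rw [h3, h2]
        rw [WithLp.toLp_smul, ← Complex.coe_smul, inner_smul_left]
        simp [hb]
      rw [hlow, WithLp.toLp_sub, WithLp.toLp_smul, inner_sub_right, inner_smul_right, h1]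
      ring
    have hsq : (δ * ‖WithLp.toLp 2 ψ‖) ^ 2 ≤
        ‖WithLp.toLp 2 ((A - (E : ℂ) • (1 : Matrix n n ℂ)).mulVec ψ)‖ ^ 2 := by
      rw [mul_pow, ← b.sum_sq_norm_inner_right, ← b.sum_sq_norm_inner_right, Finset.mul_sum]
      refine Finset.sum_le_sum fun i _ => ?_
      rw [hinner, norm_mul, mul_pow]
      have hmem : ((hA.eigenvalues i : ℝ) : ℂ) ∈ spectrum ℂ A := by
        rw [hA.spectrum_eq_image_range]
        exact ⟨_, ⟨i, rfl⟩, rfl⟩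
      have hd : δ ≤ ‖(hA.eigenvalues i : ℂ) - E‖ := by
        have := h.trans (Metric.infDist_le_dist_of_mem hmem)
        rwa [dist_comm, dist_eq_norm] at this
      gcongr
    exact le_of_sq_le_sq hsq (norm_nonneg _)
  · intro h
    have hne : (spectrum ℂ A).Nonempty := by
      rw [hA.spectrum_eq_image_range]
      exact ⟨_, ⟨_, ⟨Classical.arbitrary n, rfl⟩, rfl⟩⟩
    rw [Metric.le_infDist hne]
    intro z hz
    rw [hA.spectrum_eq_image_range] at hz
    obtain ⟨_, ⟨i, rfl⟩, rfl⟩ := hz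
    have h1 := h (hA.eigenvectorBasis i).ofLp
    rw [hlow, hA.mulVec_eigenvectorBasis i, ← Complex.coe_smul, ← sub_smul, WithLp.toLp_smul,
      norm_smul] at h1
    have h2 : ‖WithLp.toLp 2 (hA.eigenvectorBasis i).ofLp‖ = 1 := by simp
    rw [h2, mul_one, mul_one] at h1
    rw [dist_comm, dist_eq_norm]
    exact h1

theorem isUnit_det_of_mulVec_bound {A : Matrix n n ℂ} {δ : ℝ} (hδ : 0 < δ)
    (h : ∀ ψ : n → ℂ, δ * ‖WithLp.toLp 2 ψ‖ ≤ ‖WithLp.toLp 2 (A.mulVec ψ)‖) :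
    IsUnit A.det := by
  rw [isUnit_iff_ne_zero]
  intro h0
  obtain ⟨ψ, hψ, hA⟩ := Matrix.exists_mulVec_eq_zero_iff.2 h0
  have h1 := h ψ
  rw [hA] at h1
  simp only [WithLp.toLp_zero, norm_zero] at h1
  have h2 : 0 < ‖WithLp.toLp 2 ψ‖ := by
    rw [norm_pos_iff]
    simpa using hψ
  nlinarith

theorem norm_inv_apply_le {A : Matrix n n ℂ} {δ : ℝ} (hδ : 0 < δ)
    (h : ∀ ψ : n → ℂ, δ * ‖WithLp.toLp 2 ψ‖ ≤ ‖WithLp.toLp 2 (A.mulVec ψ)‖) (i j : n) :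
    ‖A⁻¹ i j‖ ≤ δ⁻¹ := by
  have hu := isUnit_det_of_mulVec_bound hδ h
  have h1 := h (A⁻¹.mulVec (Pi.single j 1))
  rw [Matrix.mulVec_mulVec, Matrix.mul_nonsing_inv _ hu, Matrix.one_mulVec] at h1
  have h2 : ‖WithLp.toLp 2 (Pi.single j (1 : ℂ) : n → ℂ)‖ = 1 := by
    simp
  rw [h2] at h1
  have h3 : ‖A⁻¹ i j‖ ≤ ‖WithLp.toLp 2 (A⁻¹.mulVec (Pi.single j (1 : ℂ)))‖ := by
    have := PiLp.norm_apply_le (WithLp.toLp 2 (A⁻¹.mulVec (Pi.single j (1 : ℂ)))) i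
    simpa using this
  rw [inv_eq_one_div δ, le_div_iff₀ hδ]
  nlinarith

end Matrix

/-! ### Subadditivity of powers of the logarithm -/

/-- The decay profile `log^ρ (t + e^ρ)`, a subadditive substitute for `log^ρ (t + 1)`. -/
noncomputable def profile (ρ t : ℝ) : ℝ := Real.log (t + Real.exp ρ) ^ ρ

theorem log_rpow_div_self_antitoneOn {ρ : ℝ} (hρ : 0 < ρ) :
    AntitoneOn (fun s : ℝ => Real.log s ^ ρ / s) {s | Real.exp ρ ≤ s} := by
  have h := Real.log_div_self_rpow_antitoneOn (a := ρ⁻¹) (inv_pos.2 hρ)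
  intro s hs t ht hst
  simp only [Set.mem_ofPred_eq] at hs ht
  have hs0 : 0 < s := (Real.exp_pos _).trans_le hs
  have ht0 : 0 < t := (Real.exp_pos _).trans_le ht
  have h1 : (1:ℝ) ≤ s := (Real.one_le_exp hρ.le).trans hs
  have key := h (a := s) (b := t) (by simpa using hs) (by simpa using ht) hst
  have hl : ∀ u : ℝ, 1 ≤ u → (Real.log u / u ^ ρ⁻¹) ^ ρ = Real.log u ^ ρ / u := by
    intro u hu
    have hu0 : 0 ≤ u := by linarith
    rw [Real.div_rpow (Real.log_nonneg hu) (Real.rpow_nonneg hu0 _), ← Real.rpow_mul hu0,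
      inv_mul_cancel₀ hρ.ne', Real.rpow_one]
  have := Real.rpow_le_rpow (div_nonneg (Real.log_nonneg (h1.trans hst))
    (Real.rpow_nonneg ht0.le _)) key hρ.le
  rwa [hl _ h1, hl _ (h1.trans hst)] at this

/-- Since `log^ρ s / s` decreases beyond `e^ρ`, the values at `s` and `t` are at least the shares
`s/u` and `t/u` of the value at `u`. -/
theorem log_rpow_subadditive {ρ s t u : ℝ} (hρ : 0 < ρ) (hs : Real.exp ρ ≤ s)
    (ht : Real.exp ρ ≤ t) (hsu : s ≤ u) (htu : t ≤ u) (hu : u ≤ s + t) :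
    Real.log u ^ ρ ≤ Real.log s ^ ρ + Real.log t ^ ρ := by
  have hs0 : 0 < s := (Real.exp_pos _).trans_le hs
  have ht0 : 0 < t := (Real.exp_pos _).trans_le ht
  have hu0 : 0 < u := hs0.trans_le hsu
  have a1 := log_rpow_div_self_antitoneOn hρ (a := s) (b := u) hs (hs.trans hsu) hsu
  have a2 := log_rpow_div_self_antitoneOn hρ (a := t) (b := u) ht (ht.trans htu) htu
  have h1 : 1 ≤ u := (Real.one_le_exp hρ.le).trans (hs.trans hsu)
  simp only at a1 a2
  set c := Real.log u ^ ρ / u with hc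
  have hc0 : 0 ≤ c := div_nonneg (Real.rpow_nonneg (Real.log_nonneg h1) _) hu0.le
  rw [le_div_iff₀ hs0] at a1
  rw [le_div_iff₀ ht0] at a2
  have : Real.log u ^ ρ = c * u := by rw [hc]; field_simp
  rw [this]
  nlinarith

theorem profile_add_le {ρ a b : ℝ} (hρ : 0 < ρ) (ha : 0 ≤ a) (hb : 0 ≤ b) :
    profile ρ (a + b) ≤ profile ρ a + profile ρ b := by
  have := Real.exp_pos ρ
  apply log_rpow_subadditive hρ <;> linarith

theorem profile_mono {ρ a b : ℝ} (hρ : 0 < ρ) (ha : 0 ≤ a) (hab : a ≤ b) :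
    profile ρ a ≤ profile ρ b := by
  have h1 := Real.one_le_exp hρ.le
  exact Real.rpow_le_rpow (Real.log_nonneg (by linarith))
    (Real.log_le_log (by linarith) (by linarith)) hρ.le

theorem profile_nonneg {ρ a : ℝ} (hρ : 0 < ρ) (ha : 0 ≤ a) : 0 ≤ profile ρ a := by
  have h1 := Real.one_le_exp hρ.le
  exact Real.rpow_nonneg (Real.log_nonneg (by linarith)) _

theorem log_rpow_le_profile {ρ a : ℝ} (hρ : 0 < ρ) (ha : 0 ≤ a) :
    Real.log (a + 1) ^ ρ ≤ profile ρ a := by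
  have h1 := Real.one_le_exp hρ.le
  exact Real.rpow_le_rpow (Real.log_nonneg (by linarith))
    (Real.log_le_log (by linarith) (by linarith)) hρ.le

/-- The largest gap between `profile ρ` and `log^ρ (· + 1)`, up to a crude bound. -/
noncomputable def profileGap (ρ : ℝ) : ℝ := Real.log (2 * Real.exp ρ) ^ ρ

theorem profileGap_nonneg {ρ : ℝ} (hρ : 0 < ρ) : 0 ≤ profileGap ρ := by
  have h1 := Real.one_le_exp hρ.le
  exact Real.rpow_nonneg (Real.log_nonneg (by linarith)) _

theorem profile_le_add_gap {ρ a : ℝ} (hρ : 0 < ρ) (ha : 0 ≤ a) :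
    profile ρ a ≤ Real.log (a + 1) ^ ρ + profileGap ρ := by
  have h1 := Real.one_le_exp hρ.le
  have h0 := Real.exp_pos ρ
  rcases le_or_gt (Real.exp ρ) (a + 1) with h | h
  · have h2 : profile ρ a ≤ Real.log (a + 1) ^ ρ + Real.log (Real.exp ρ) ^ ρ := by
      apply log_rpow_subadditive hρ <;> linarith
    have h3 : Real.log (Real.exp ρ) ^ ρ ≤ profileGap ρ :=
      Real.rpow_le_rpow (Real.log_nonneg h1) (Real.log_le_log h0 (by linarith)) hρ.le
    linarith
  · have h2 : profile ρ a ≤ profileGap ρ :=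
      Real.rpow_le_rpow (Real.log_nonneg (by linarith))
        (Real.log_le_log (by linarith) (by linarith)) hρ.le
    have h3 : 0 ≤ Real.log (a + 1) ^ ρ := Real.rpow_nonneg (Real.log_nonneg (by linarith)) _
    linarith

variable {d : ℕ}

/-! ### The maximum norm as a natural number -/

/-- The maximum norm on `ℤ^d` as a natural number. -/
def supNorm (u : Fin d → ℤ) : ℕ := Finset.univ.sup fun i => (u i).natAbs

theorem supNorm_le_iff (u : Fin d → ℤ) (n : ℕ) : supNorm u ≤ n ↔ ∀ i, (u i).natAbs ≤ n := by
  simp [supNorm]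

theorem natAbs_le_supNorm (u : Fin d → ℤ) (i : Fin d) : (u i).natAbs ≤ supNorm u :=
  (supNorm_le_iff u _).1 le_rfl i

theorem norm_eq_supNorm (u : Fin d → ℤ) : ‖u‖ = (supNorm u : ℝ) := by
  have habs : ∀ i, ‖u i‖ = ((u i).natAbs : ℝ) := fun i => by
    rw [Int.norm_eq_abs, Nat.cast_natAbs, Int.cast_abs]
  apply le_antisymm
  · rw [pi_norm_le_iff_of_nonneg (Nat.cast_nonneg _)]
    intro i
    rw [habs]
    exact_mod_cast natAbs_le_supNorm u i
  · have h : supNorm u ≤ ⌊‖u‖⌋₊ := by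
      rw [supNorm_le_iff]
      intro i
      rw [Nat.le_floor_iff (norm_nonneg _), ← habs]
      exact norm_le_pi_norm u i
    exact (Nat.le_floor_iff (norm_nonneg _)).1 h

theorem supNorm_sub_comm (u w : Fin d → ℤ) : supNorm (u - w) = supNorm (w - u) := by
  have := norm_sub_rev u w
  rw [norm_eq_supNorm, norm_eq_supNorm] at this
  exact_mod_cast this

theorem supNorm_sub_le (u w z : Fin d → ℤ) :
    supNorm (u - z) ≤ supNorm (u - w) + supNorm (w - z) := by
  have := norm_sub_le_norm_sub_add_norm_sub u w z
  rw [norm_eq_supNorm, norm_eq_supNorm, norm_eq_supNorm] at this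
  exact_mod_cast this

theorem mem_cube_iff (L : ℕ) (x y : Fin d → ℤ) : y ∈ cube L x ↔ supNorm (y - x) ≤ L := by
  rw [mem_cube, norm_eq_supNorm, Nat.cast_le]

theorem card_cube (L : ℕ) (x : Fin d → ℤ) : (cube L x).card = (2 * L + 1) ^ d := by
  rw [cube, Pi.card_Icc]
  have : ∀ i : Fin d, (Finset.Icc (x i - (L : ℤ)) (x i + (L : ℤ))).card = 2 * L + 1 := by
    intro i
    rw [Int.card_Icc]
    omega
  simp [this]

/-! ### Green's functions -/

section Green

variable (ε : ℝ) (φ : (Fin d → ℤ) → ℂ) (v : (Fin d → ℤ) → ℝ)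

theorem restrict_isHermitian {γ ρ : ℝ} (hφ : IsHopping γ ρ φ) (B : Finset (Fin d → ℤ)) :
    (restrict ε φ v B).IsHermitian := by
  ext i j
  simp only [Matrix.conjTranspose_apply, restrict, Matrix.of_apply, kernel, star_add, star_mul']
  rw [hφ.hermitian (i : Fin d → ℤ) j]
  congr 1
  · simp
  · by_cases h : (i : Fin d → ℤ) = j
    · simp [h]
    · simp [h, Ne.symm h]

theorem isNR_iff {γ ρ : ℝ} (hφ : IsHopping γ ρ φ) (ρ' E : ℝ) (L : ℕ) (x : Fin d → ℤ) :
    IsNR ρ' ε φ v E L x ↔ ∀ ψ : cube L x → ℂ,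
      Real.exp (-(Real.log L ^ ρ')) * ‖WithLp.toLp 2 ψ‖ ≤
        ‖WithLp.toLp 2 ((restrict ε φ v (cube L x) -
          (E : ℂ) • (1 : Matrix (cube L x) (cube L x) ℂ)).mulVec ψ)‖ := by
  have : Nonempty (cube L x) := ⟨⟨x, self_mem_cube L x⟩⟩
  exact le_infDist_spectrum_iff (restrict_isHermitian ε φ v hφ _) E _

/-- Green's function of `B`, extended by zero to `ℤ^d × ℤ^d`. -/
noncomputable def greenExt (B : Finset (Fin d → ℤ)) (E : ℝ) (u w : Fin d → ℤ) : ℂ :=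
  if h : u ∈ B ∧ w ∈ B then green ε φ v B E ⟨u, h.1⟩ ⟨w, h.2⟩ else 0

variable {ε φ v}

theorem greenExt_coe {B : Finset (Fin d → ℤ)} {E : ℝ} (u w : B) :
    greenExt ε φ v B E u w = green ε φ v B E u w := by
  simp [greenExt]

theorem norm_greenExt_le_of_isNR {γ ρ ρ' E : ℝ} (hφ : IsHopping γ ρ φ) {L : ℕ} {x : Fin d → ℤ}
    (h : IsNR ρ' ε φ v E L x) (u w : Fin d → ℤ) :
    ‖greenExt ε φ v (cube L x) E u w‖ ≤ Real.exp (Real.log L ^ ρ') := by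
  rw [isNR_iff ε φ v hφ] at h
  by_cases hm : u ∈ cube L x ∧ w ∈ cube L x
  · rw [greenExt, dif_pos hm]
    have := norm_inv_apply_le (Real.exp_pos _) h ⟨u, hm.1⟩ ⟨w, hm.2⟩
    rwa [← Real.exp_neg, neg_neg] at this
  · rw [greenExt, dif_neg hm, norm_zero]
    positivity

theorem isUnit_det_of_isNR {γ ρ ρ' E : ℝ} (hφ : IsHopping γ ρ φ) {L : ℕ} {x : Fin d → ℤ}
    (h : IsNR ρ' ε φ v E L x) :
    IsUnit (restrict ε φ v (cube L x) -
      (E : ℂ) • (1 : Matrix (cube L x) (cube L x) ℂ)).det := by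
  rw [isNR_iff ε φ v hφ] at h
  exact isUnit_det_of_mulVec_bound (Real.exp_pos _) h

theorem sum_kernel_mul_greenExt {B : Finset (Fin d → ℤ)} {E : ℝ}
    (h : IsUnit (restrict ε φ v B - (E : ℂ) • (1 : Matrix B B ℂ)).det) {w y : Fin d → ℤ}
    (hw : w ∈ B) (hy : y ∈ B) :
    ∑ z ∈ B, (kernel ε φ v w z - if w = z then (E : ℂ) else 0) * greenExt ε φ v B E z y =
      if w = y then 1 else 0 := by
  have h1 := congrFun (congrFun (Matrix.mul_nonsing_inv _ h) ⟨w, hw⟩) ⟨y, hy⟩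
  rw [Matrix.mul_apply, Matrix.one_apply] at h1
  rw [← Finset.sum_coe_sort B]
  simp only [Subtype.mk.injEq] at h1
  rw [← h1]
  refine Finset.sum_congr rfl fun z _ => ?_
  rw [greenExt_coe z ⟨y, hy⟩]
  congr 1
  simp only [restrict, Matrix.sub_apply, Matrix.of_apply, Matrix.smul_apply, Matrix.one_apply,
    Subtype.ext_iff, smul_eq_mul, mul_ite, mul_one, mul_zero]

theorem sum_greenExt_mul_kernel {B : Finset (Fin d → ℤ)} {E : ℝ}
    (h : IsUnit (restrict ε φ v B - (E : ℂ) • (1 : Matrix B B ℂ)).det) {u z : Fin d → ℤ}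
    (hu : u ∈ B) (hz : z ∈ B) :
    ∑ w ∈ B, greenExt ε φ v B E u w * (kernel ε φ v w z - if w = z then (E : ℂ) else 0) =
      if u = z then 1 else 0 := by
  have h1 := congrFun (congrFun (Matrix.nonsing_inv_mul _ h) ⟨u, hu⟩) ⟨z, hz⟩
  rw [Matrix.mul_apply, Matrix.one_apply] at h1
  rw [← Finset.sum_coe_sort B]
  simp only [Subtype.mk.injEq] at h1
  rw [← h1]
  refine Finset.sum_congr rfl fun w _ => ?_
  rw [greenExt_coe ⟨u, hu⟩ w]
  congr 1
  simp only [restrict, Matrix.sub_apply, Matrix.of_apply, Matrix.smul_apply, Matrix.one_apply,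
    Subtype.ext_iff, smul_eq_mul, mul_ite, mul_one, mul_zero]

/-- The geometric resolvent identity. -/
theorem greenExt_eq_neg_sum {B Λ : Finset (Fin d → ℤ)} {E : ℝ} (hB : B ⊆ Λ)
    (hBu : IsUnit (restrict ε φ v B - (E : ℂ) • (1 : Matrix B B ℂ)).det)
    (hΛu : IsUnit (restrict ε φ v Λ - (E : ℂ) • (1 : Matrix Λ Λ ℂ)).det)
    {u y : Fin d → ℤ} (hu : u ∈ B) (hy : y ∈ Λ) (hyB : y ∉ B) :
    greenExt ε φ v Λ E u y = -∑ w ∈ B, ∑ z ∈ Λ \ B,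
      greenExt ε φ v B E u w * ((ε : ℂ) * φ (w - z)) * greenExt ε φ v Λ E z y := by
  set k : (Fin d → ℤ) → (Fin d → ℤ) → ℂ :=
    fun w z => kernel ε φ v w z - if w = z then (E : ℂ) else 0 with hk
  have h1 : greenExt ε φ v Λ E u y =
      ∑ z ∈ B, (∑ w ∈ B, greenExt ε φ v B E u w * k w z) * greenExt ε φ v Λ E z y := by
    rw [Finset.sum_congr rfl fun z hz => by rw [sum_greenExt_mul_kernel hBu hu hz]]
    simp [hu]
  have h2 : ∀ w ∈ B, ∑ z ∈ B, k w z * greenExt ε φ v Λ E z y =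
      -∑ z ∈ Λ \ B, ((ε : ℂ) * φ (w - z)) * greenExt ε φ v Λ E z y := by
    intro w hw
    have h3 := sum_kernel_mul_greenExt hΛu (hB hw) hy
    have hwy : w ≠ y := fun h => hyB (h ▸ hw)
    rw [if_neg hwy, ← Finset.sum_sdiff hB] at h3
    rw [eq_neg_iff_add_eq_zero, add_comm, ← h3]
    congr 1
    refine Finset.sum_congr rfl fun z hz => ?_
    have hne : w ≠ z := fun h => (Finset.mem_sdiff.1 hz).2 (h ▸ hw)
    simp [kernel, hne]
  rw [h1, ← Finset.sum_neg_distrib]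
  simp_rw [Finset.sum_mul]
  rw [Finset.sum_comm]
  refine Finset.sum_congr rfl fun w hw => ?_
  simp_rw [mul_assoc]
  rw [← Finset.mul_sum, h2 w hw, mul_neg, Finset.mul_sum]
  simp_rw [mul_assoc]

/-- One step of the resolvent expansion, in weighted form. -/
theorem norm_greenExt_mul_weight_le {B Λ : Finset (Fin d → ℤ)} {E : ℝ} (hB : B ⊆ Λ)
    (hBu : IsUnit (restrict ε φ v B - (E : ℂ) • (1 : Matrix B B ℂ)).det)
    (hΛu : IsUnit (restrict ε φ v Λ - (E : ℂ) • (1 : Matrix Λ Λ ℂ)).det)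
    {u y : Fin d → ℤ} (hu : u ∈ B) (hy : y ∈ Λ) (hyB : y ∉ B) {W : (Fin d → ℤ) → ℝ} {θ M : ℝ}
    (hW : 0 ≤ W u) (hθ : 0 ≤ θ)
    (hM : ∀ z ∈ Λ, ‖greenExt ε φ v Λ E z y‖ * W z ≤ M)
    (hM0 : 0 ≤ M)
    (hterm : ∀ w ∈ B, ∀ z ∈ Λ \ B,
      ‖greenExt ε φ v B E u w‖ * ‖(ε : ℂ) * φ (w - z)‖ * W u ≤ θ * W z) :
    ‖greenExt ε φ v Λ E u y‖ * W u ≤ (Λ.card : ℝ) ^ 2 * θ * M := by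
  rw [greenExt_eq_neg_sum hB hBu hΛu hu hy hyB, norm_neg]
  have hle : ‖∑ w ∈ B, ∑ z ∈ Λ \ B,
      greenExt ε φ v B E u w * ((ε : ℂ) * φ (w - z)) * greenExt ε φ v Λ E z y‖ * W u ≤
      ∑ w ∈ B, ∑ z ∈ Λ \ B, θ * M := by
    refine (mul_le_mul_of_nonneg_right ((norm_sum_le _ _).trans
      (Finset.sum_le_sum fun w _ => norm_sum_le _ _)) hW).trans ?_
    rw [Finset.sum_mul]
    refine Finset.sum_le_sum fun w hw => ?_
    rw [Finset.sum_mul]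
    refine Finset.sum_le_sum fun z hz => ?_
    rw [norm_mul, norm_mul]
    have h1 := hterm w hw z hz
    have h2 := hM z (Finset.mem_sdiff.1 hz).1
    calc _ = ‖greenExt ε φ v B E u w‖ * ‖(ε : ℂ) * φ (w - z)‖ * W u *
          ‖greenExt ε φ v Λ E z y‖ := by ring
      _ ≤ θ * W z * ‖greenExt ε φ v Λ E z y‖ := by gcongr
      _ = θ * (‖greenExt ε φ v Λ E z y‖ * W z) := by ring
      _ ≤ θ * M := by gcongr
  refine hle.trans ?_
  simp only [Finset.sum_const, nsmul_eq_mul]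
  have h1 : (B.card : ℝ) ≤ Λ.card := by exact_mod_cast Finset.card_le_card hB
  have h2 : ((Λ \ B).card : ℝ) ≤ Λ.card := by
    exact_mod_cast Finset.card_le_card Finset.sdiff_subset
  have h3 : 0 ≤ θ * M := mul_nonneg hθ hM0
  calc (B.card : ℝ) * (((Λ \ B).card : ℝ) * (θ * M))
      ≤ (Λ.card : ℝ) * ((Λ.card : ℝ) * (θ * M)) := by gcongr
    _ = (Λ.card : ℝ) ^ 2 * θ * M := by ring

end Green

/-- At a maximiser, with `M` the maximum itself, the second alternative reads `F ≤ F/2`. This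
replaces an iterated expansion and its count of steps. -/
theorem max_principle {ι : Type*} {Λ : Finset ι} {F : ι → ℝ} {C : ℝ} (hC : 0 ≤ C)
    (hF : ∀ u ∈ Λ, 0 ≤ F u)
    (h : ∀ u ∈ Λ, F u ≤ C ∨ ∀ M, 0 ≤ M → (∀ w ∈ Λ, F w ≤ M) → F u ≤ M / 2) :
    ∀ u ∈ Λ, F u ≤ C := by
  intro u hu
  obtain ⟨m, hm, hmax⟩ := Finset.exists_max_image Λ F ⟨u, hu⟩
  rcases h m hm with h1 | h1
  · exact (hmax u hu).trans h1
  · have h2 := h1 (F m) (hF m hm) hmax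
    have h3 := hmax u hu
    linarith

/-! ### Counting radii outside finitely many shells -/

/-- The number of `k < n` outside all the shells `{k : |k - c z| ≤ r z}`, `z ∈ T`. -/
def freeCount {ι : Type*} (T : Finset ι) (c r : ι → ℕ) (n : ℕ) : ℕ :=
  ((Finset.range n).filter fun k => ∀ z ∈ T, ¬ (c z ≤ k + r z ∧ k ≤ c z + r z)).card

section FreeCount

variable {ι : Type*} {T : Finset ι} {c r : ι → ℕ}

theorem freeCount_mono {m n : ℕ} (h : m ≤ n) : freeCount T c r m ≤ freeCount T c r n :=
  Finset.card_le_card (Finset.filter_subset_filter _ (Finset.range_mono h))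

theorem freeCount_le_add {m n k : ℕ} (h : n ≤ m + k) :
    freeCount T c r n ≤ freeCount T c r m + k := by
  refine (freeCount_mono h).trans ?_
  unfold freeCount
  have hsub : ((Finset.range (m + k)).filter
      fun k => ∀ z ∈ T, ¬ (c z ≤ k + r z ∧ k ≤ c z + r z)) ⊆
      ((Finset.range m).filter fun k => ∀ z ∈ T, ¬ (c z ≤ k + r z ∧ k ≤ c z + r z)) ∪
        Finset.Ico m (m + k) := by
    intro j hj
    simp only [Finset.mem_filter, Finset.mem_range, Finset.mem_union, Finset.mem_Ico] at hj ⊢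
    by_cases hjm : j < m
    · exact Or.inl ⟨hjm, hj.2⟩
    · exact Or.inr ⟨by omega, hj.1⟩
  refine (Finset.card_le_card hsub).trans ((Finset.card_union_le _ _).trans ?_)
  simp

/-- No counted radius lies between two radii of the same shell, so moving inside a box uses up
nothing. -/
theorem freeCount_le_of_mem_shell {m n : ℕ} {z : ι} (hz : z ∈ T) (hm : c z ≤ m + r z)
    (hn : n ≤ c z + r z) : freeCount T c r n ≤ freeCount T c r m := by
  refine Finset.card_le_card ?_
  intro j hj
  simp only [Finset.mem_filter, Finset.mem_range] at hj ⊢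
  refine ⟨?_, hj.2⟩
  by_contra hjm
  exact hj.2 z hz ⟨by omega, by omega⟩

theorem le_freeCount_add (n : ℕ) :
    n ≤ freeCount T c r n + ∑ z ∈ T, (2 * r z + 1) := by
  classical
  have hsub : Finset.range n ⊆
      ((Finset.range n).filter fun k => ∀ z ∈ T, ¬ (c z ≤ k + r z ∧ k ≤ c z + r z)) ∪
        T.biUnion fun z => Finset.Icc (c z - r z) (c z + r z) := by
    intro j hj
    simp only [Finset.mem_filter, Finset.mem_union, Finset.mem_biUnion, Finset.mem_Icc]
    by_cases h : ∀ z ∈ T, ¬ (c z ≤ j + r z ∧ j ≤ c z + r z)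
    · exact Or.inl ⟨hj, h⟩
    · push Not at h
      obtain ⟨z, hz, h1, h2⟩ := h
      exact Or.inr ⟨z, hz, by omega, h2⟩
  have h1 := (Finset.card_le_card hsub).trans (Finset.card_union_le _ _)
  rw [Finset.card_range] at h1
  refine h1.trans (Nat.add_le_add_left (Finset.card_biUnion_le.trans ?_) _)
  refine Finset.sum_le_sum fun z _ => ?_
  rw [Nat.card_Icc]
  omega

end FreeCount

/-! ### Covering the bad sites by separated cubes -/

/-- The `8l`-ball at `a` absorbs the `2l`-ball at `b`. If `c` is within `24l` of `a`, the `26l`-ball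
at `a` absorbs all three; otherwise `24l` leaves room for `8l + 2l + l`. -/
theorem exists_cover_of_close (l : ℕ) (Λ : Finset (Fin d → ℤ)) (bad : (Fin d → ℤ) → Prop)
    {a b c : Fin d → ℤ} (ha : a ∈ Λ) (hc : c ∈ Λ) (hab : supNorm (b - a) ≤ 6 * l)
    (hcov : ∀ z ∈ Λ, bad z →
      supNorm (z - a) ≤ 2 * l ∨ supNorm (z - b) ≤ 2 * l ∨ supNorm (z - c) ≤ 2 * l) :
    ∃ (T : Finset (Fin d → ℤ)) (r : (Fin d → ℤ) → ℕ), T ⊆ Λ ∧ T.card ≤ 3 ∧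
      (∀ z, r z = 2 * l ∨ r z = 8 * l ∨ r z = 26 * l) ∧
      (∀ z ∈ T, ∀ z' ∈ T, z ≠ z' → r z + r z' + l ≤ supNorm (z - z')) ∧
      ∀ z ∈ Λ, bad z → ∃ t ∈ T, supNorm (z - t) ≤ r t := by
  by_cases hac : supNorm (c - a) ≤ 24 * l
  · refine ⟨{a}, fun _ => 26 * l, by simpa using ha, by simp, by simp, ?_, ?_⟩
    · intro z hz z' hz' hne
      simp only [Finset.mem_singleton] at hz hz'
      exact absurd (hz.trans hz'.symm) hne
    · intro z hz hb
      refine ⟨a, by simp, ?_⟩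
      change _ ≤ 26 * l
      have h1 := supNorm_sub_le z b a
      have h2 := supNorm_sub_le z c a
      rcases hcov z hz hb with h | h | h <;> omega
  · push Not at hac
    have hca : c ≠ a := by
      rintro rfl
      simp [supNorm] at hac
    refine ⟨{a, c}, fun z => if z = a then 8 * l else 2 * l, ?_, ?_, ?_, ?_, ?_⟩
    · intro z hz
      simp only [Finset.mem_insert, Finset.mem_singleton] at hz
      rcases hz with rfl | rfl <;> assumption
    · exact (Finset.card_le_two).trans (by norm_num)
    · intro z
      by_cases h : z = a <;> simp [h]
    · intro z hz z' hz' hne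
      simp only [Finset.mem_insert, Finset.mem_singleton] at hz hz'
      have := supNorm_sub_comm a c
      rcases hz with rfl | rfl <;> rcases hz' with rfl | rfl
      · exact absurd rfl hne
      · simp only [if_true, if_neg hca]; omega
      · simp only [if_true, if_neg hca]; omega
      · exact absurd rfl hne
    · intro z hz hb
      have h1 := supNorm_sub_le z b a
      rcases hcov z hz hb with h | h | h
      · exact ⟨a, by simp, by simp only [if_true]; omega⟩
      · exact ⟨a, by simp, by simp only [if_true]; omega⟩
      · exact ⟨c, by simp, by simp only [if_neg hca]; omega⟩

/-- A maximal `2l`-separated family of bad sites has at most three members, and its `2l`-balls cover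
the bad sites. Balls with centres within `6l` are merged; otherwise radius `2l` already leaves gaps
of `l`. -/
theorem exists_separated_cover (l : ℕ) (Λ : Finset (Fin d → ℤ)) (bad : (Fin d → ℤ) → Prop)
    (h : ¬ ∃ a ∈ Λ, ∃ b ∈ Λ, ∃ c ∈ Λ, ∃ e ∈ Λ, bad a ∧ bad b ∧ bad c ∧ bad e ∧
      2 * l < supNorm (b - a) ∧ 2 * l < supNorm (c - a) ∧ 2 * l < supNorm (c - b) ∧
      2 * l < supNorm (e - a) ∧ 2 * l < supNorm (e - b) ∧ 2 * l < supNorm (e - c)) :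
    ∃ (T : Finset (Fin d → ℤ)) (r : (Fin d → ℤ) → ℕ), T ⊆ Λ ∧ T.card ≤ 3 ∧
      (∀ z, r z = 2 * l ∨ r z = 8 * l ∨ r z = 26 * l) ∧
      (∀ z ∈ T, ∀ z' ∈ T, z ≠ z' → r z + r z' + l ≤ supNorm (z - z')) ∧
      ∀ z ∈ Λ, bad z → ∃ t ∈ T, supNorm (z - t) ≤ r t := by
  by_cases h0 : ∃ a ∈ Λ, bad a
  swap
  · push Not at h0
    exact ⟨∅, fun _ => 2 * l, by simp, by simp, by simp, by simp,
      fun z hz hb => absurd hb (h0 z hz)⟩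
  obtain ⟨a, ha, hba⟩ := h0
  obtain ⟨b, hb, c, hc, hcov⟩ : ∃ b ∈ Λ, ∃ c ∈ Λ, ∀ z ∈ Λ, bad z →
      supNorm (z - a) ≤ 2 * l ∨ supNorm (z - b) ≤ 2 * l ∨ supNorm (z - c) ≤ 2 * l := by
    by_cases h1 : ∃ b ∈ Λ, bad b ∧ 2 * l < supNorm (b - a)
    swap
    · push Not at h1
      -- Repeated centres fill the places of missing ones; the merging case then applies.
      exact ⟨a, ha, a, ha, fun z hz hbz => Or.inl (h1 z hz hbz)⟩
    obtain ⟨b, hb, hbb, hab⟩ := h1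
    by_cases h2 : ∃ c ∈ Λ, bad c ∧ 2 * l < supNorm (c - a) ∧ 2 * l < supNorm (c - b)
    swap
    · push Not at h2
      refine ⟨b, hb, b, hb, fun z hz hbz => ?_⟩
      by_cases hza : supNorm (z - a) ≤ 2 * l
      · exact Or.inl hza
      · exact Or.inr (Or.inl (h2 z hz hbz (not_le.1 hza)))
    obtain ⟨c, hc, hbc, hac, hbc'⟩ := h2
    refine ⟨b, hb, c, hc, fun z hz hbz => ?_⟩
    by_contra hcon
    push Not at hcon
    exact h ⟨a, ha, b, hb, c, hc, z, hz, hba, hbb, hbc, hbz, hab, hac, hbc', hcon⟩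
  by_cases h1 : supNorm (b - a) ≤ 6 * l
  · exact exists_cover_of_close l Λ bad ha hc h1 hcov
  by_cases h2 : supNorm (c - a) ≤ 6 * l
  · exact exists_cover_of_close l Λ bad ha hb h2 fun z hz hbz => by
      have := hcov z hz hbz
      tauto
  by_cases h3 : supNorm (c - b) ≤ 6 * l
  · exact exists_cover_of_close l Λ bad hb ha h3 fun z hz hbz => by
      have := hcov z hz hbz
      tauto
  have e1 := supNorm_sub_comm a b
  have e2 := supNorm_sub_comm a c
  have e3 := supNorm_sub_comm b c
  refine ⟨{a, b, c}, fun _ => 2 * l, ?_, Finset.card_le_three, by simp, ?_, ?_⟩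
  · intro z hz
    simp only [Finset.mem_insert, Finset.mem_singleton] at hz
    rcases hz with rfl | rfl | rfl <;> assumption
  · intro z hz z' hz' hne
    simp only [Finset.mem_insert, Finset.mem_singleton] at hz hz'
    change 2 * l + 2 * l + l ≤ _
    rcases hz with rfl | rfl | rfl <;> rcases hz' with rfl | rfl | rfl <;>
      first | exact absurd rfl hne | omega
  · intro z hz hbz
    rcases hcov z hz hbz with h | h | h
    · exact ⟨a, by simp, h⟩
    · exact ⟨b, by simp, h⟩
    · exact ⟨c, by simp, h⟩

/-! ### Decay of Green's function at the next scale -/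

theorem hopping_term_le {g h : ℂ} {ε ε₁ A B s t m K : ℝ} (hε : 0 < ε) (hε₁ : ε ≤ ε₁)
    (hg : ‖g‖ ≤ Real.exp A) (hh : ‖h‖ ≤ Real.exp B) (hsum : A + B + s ≤ K - m + t) :
    ‖g‖ * ‖(ε : ℂ) * h‖ * Real.exp s ≤ ε₁ * Real.exp K * Real.exp (-m) * Real.exp t := by
  rw [norm_mul, Complex.norm_real, Real.norm_of_nonneg hε.le]
  have h0 : 0 ≤ ε₁ := hε.le.trans hε₁
  calc ‖g‖ * (ε * ‖h‖) * Real.exp s ≤ Real.exp A * (ε₁ * Real.exp B) * Real.exp s := by gcongr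
    _ = ε₁ * Real.exp (A + B + s) := by rw [Real.exp_add, Real.exp_add]; ring
    _ ≤ ε₁ * Real.exp (K - m + t) := by gcongr
    _ = ε₁ * Real.exp K * Real.exp (-m) * Real.exp t := by
      rw [Real.exp_add, Real.exp_sub, Real.exp_neg]; ring

/-- The unit of loss is `m`: Green's functions are at most `e^m` on good `l`-cubes and `e^{2m}` on
boxes, and a factor `e^{-m}` absorbs constants and the number of terms. Giving up `τ` of the rate
gains `6m` on every step of length at least `l`. -/
theorem norm_greenExt_center_le {γ ρ ρ' κ ε₁ ε E τ m : ℝ} {l L : ℕ} {x y : Fin d → ℤ}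
    {φ : (Fin d → ℤ) → ℂ} {v : (Fin d → ℤ) → ℝ} {T : Finset (Fin d → ℤ)} {r : (Fin d → ℤ) → ℕ}
    (hρ : 0 < ρ) (hκ : 0 ≤ κ) (hγ : 5 * κ ≤ γ) (hφ : IsHopping γ ρ φ)
    (hε : 0 < ε) (hε₁ : ε ≤ ε₁) (hτ0 : 0 ≤ τ) (hτκ : τ ≤ κ) (hm : 0 ≤ m)
    (hτ : 6 * m ≤ τ * profile ρ l) (hpow : 2 * (l : ℝ) ^ (4 / 5 : ℝ) ≤ l)
    (habs : ε₁ * Real.exp (2 * κ * profileGap ρ) * (2 * ((cube L x).card : ℝ) ^ 2) ≤ Real.exp m)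
    (hlm : Real.log l ^ ρ' ≤ m) (hNR : IsNR ρ' ε φ v E L x)
    (hrNR : ∀ z ∈ T, IsNR ρ' ε φ v E (r z) z) (hrm : ∀ z, Real.log (r z) ^ ρ' ≤ 2 * m)
    (hr : ∀ z, r z ≤ 26 * l)
    (hsep : ∀ z ∈ T, ∀ z' ∈ T, z ≠ z' → r z + r z' + l ≤ supNorm (z - z'))
    (hcov : ∀ z ∈ cube L x, ¬ IsGood ρ ρ' ε φ v κ E l z → ∃ t ∈ T, supNorm (z - t) ≤ r t)
    (hy : y ∈ cube L x) :
    ‖greenExt ε φ v (cube L x) E x y‖ ≤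
      Real.exp (3 * m + Real.log L ^ ρ' + (κ - τ) * profile ρ 0 -
        (κ - τ) * profile ρ
          (freeCount T (fun z => supNorm (z - x)) r (supNorm (y - x) - 60 * l) : ℕ)) := by
  classical
  set Λ := cube L x with hΛ
  set R := supNorm (y - x) with hR
  set N : (Fin d → ℤ) → ℕ := fun u => freeCount T (fun z => supNorm (z - x)) r (supNorm (u - x))
    with hN
  set N₀ : ℕ := freeCount T (fun z => supNorm (z - x)) r (R - 60 * l) with hN₀
  set box : (Fin d → ℤ) → Prop := fun u => ∃ t ∈ T, supNorm (u - t) ≤ r t with hbox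
  -- The penalty `3m` pays for the box bound `e^{2m}` and the reserved `e^{-m}`. Entering a box
  -- costs `3m`, covered by the `6m` gained on the step. The subtraction truncates at zero once no
  -- radii are left.
  set w : (Fin d → ℤ) → ℝ := fun u =>
    (κ - τ) * profile ρ (N₀ - N u : ℕ) - (if box u then 3 * m else 0) with hw
  have hκτ : 0 ≤ κ - τ := by linarith
  have hRL : R ≤ L := (mem_cube_iff L x y).1 hy
  have hgap := profileGap_nonneg hρ
  have hε₁0 : 0 ≤ ε₁ := hε.le.trans hε₁
  -- the potential drops by at most the distance travelled
  have hdrop : ∀ (u z : Fin d → ℤ) (k : ℕ), N z ≤ N u + k →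
      (κ - τ) * profile ρ (N₀ - N u : ℕ) ≤
        (κ - τ) * profile ρ (N₀ - N z : ℕ) + (κ - τ) * profile ρ k := by
    intro u z k hk
    rw [← mul_add]
    refine mul_le_mul_of_nonneg_left ?_ hκτ
    refine le_trans ?_ (profile_add_le hρ (Nat.cast_nonneg _) (Nat.cast_nonneg _))
    refine profile_mono hρ (Nat.cast_nonneg _) ?_
    norm_cast
    omega
  have hfar : ∀ k : ℕ, l ≤ k → 6 * m ≤ τ * profile ρ k := fun k hk =>
    hτ.trans (mul_le_mul_of_nonneg_left
      (profile_mono hρ (Nat.cast_nonneg _) (by exact_mod_cast hk)) hτ0)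
  have hdecay : ∀ u z : Fin d → ℤ, ‖φ (u - z)‖ ≤
      Real.exp (-γ * Real.log ((supNorm (u - z) : ℝ) + 1) ^ ρ) := by
    intro u z
    rw [← norm_eq_supNorm]
    exact hφ.decay _
  have hlogpos : ∀ k : ℕ, 0 ≤ Real.log ((k : ℝ) + 1) ^ ρ := fun k =>
    Real.rpow_nonneg (Real.log_nonneg (by linarith [Nat.cast_nonneg (α := ℝ) k])) _
  -- the hopping term controls any multiple `≤ γ` of the profile
  have hhop : ∀ (k : ℕ) (c : ℝ), 0 ≤ c → c ≤ 5 * κ →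
      -γ * Real.log ((k : ℝ) + 1) ^ ρ ≤ -(c * profile ρ k) + c * profileGap ρ := by
    intro k c hc hcκ
    have h1 := profile_le_add_gap hρ (Nat.cast_nonneg (α := ℝ) k)
    have h2 := hlogpos k
    nlinarith
  have hif : ∀ u, 0 ≤ (if box u then 3 * m else 0) ∧ (if box u then 3 * m else 0) ≤ 3 * m := by
    intro u
    split_ifs <;> constructor <;> linarith
  set θ : ℝ := ε₁ * Real.exp (2 * κ * profileGap ρ) * Real.exp (-m) with hθ
  have hθ0 : 0 ≤ θ := by positivity
  have hθcard : (Λ.card : ℝ) ^ 2 * θ ≤ 1 / 2 := by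
    have h1 : Real.exp m * Real.exp (-m) = 1 := by rw [← Real.exp_add]; simp
    have h2 := mul_le_mul_of_nonneg_right habs (Real.exp_pos (-m)).le
    rw [h1] at h2
    rw [hθ]
    linarith
  have hΛu := isUnit_det_of_isNR hφ hNR
  have hmain : ∀ u ∈ Λ, ‖greenExt ε φ v Λ E u y‖ * Real.exp (w u) ≤
      Real.exp (Real.log L ^ ρ' + (κ - τ) * profile ρ 0) := by
    refine max_principle (Real.exp_pos _).le (fun u _ => by positivity) fun u hu => ?_
    by_cases hq : N₀ ≤ N u
    · left
      have h1 := norm_greenExt_le_of_isNR hφ hNR u y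
      rw [Real.exp_add]
      refine mul_le_mul h1 (Real.exp_le_exp.2 ?_) (Real.exp_pos _).le (Real.exp_pos _).le
      simp only [hw, Nat.sub_eq_zero_of_le hq, Nat.cast_zero]
      linarith [(hif u).1]
    right
    intro M hM0 hM
    -- The margin `60l` exceeds the largest box diameter `52l`, so a box through `u` stays inside
    -- `Λ` and misses `y`.
    have hux : supNorm (u - x) < R - 60 * l := by
      by_contra hcon
      exact hq (freeCount_mono (not_lt.1 hcon))
    suffices h : ‖greenExt ε φ v Λ E u y‖ * Real.exp (w u) ≤ (Λ.card : ℝ) ^ 2 * θ * M by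
      nlinarith
    by_cases hub : box u
    · obtain ⟨t, htT, hut⟩ := hub
      have hrt := hr t
      have htx := supNorm_sub_le t u x
      have htu := supNorm_sub_comm t u
      refine norm_greenExt_mul_weight_le (B := cube (r t) t) (W := fun u => Real.exp (w u)) ?_
        (isUnit_det_of_isNR hφ (hrNR t htT)) hΛu ?_ hy ?_ (Real.exp_pos _).le hθ0 hM hM0 ?_
      · intro z hz
        rw [mem_cube_iff] at hz
        rw [mem_cube_iff]
        have := supNorm_sub_le z t x
        omega
      · rwa [mem_cube_iff]
      · rw [mem_cube_iff]
        intro hyt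
        have := supNorm_sub_le y t x
        omega
      · intro s hs z hz
        rw [mem_cube_iff] at hs
        rw [Finset.mem_sdiff, mem_cube_iff (r t)] at hz
        obtain ⟨hzΛ, hzt⟩ := hz
        refine hopping_term_le hε hε₁ ((norm_greenExt_le_of_isNR hφ (hrNR t htT) u s).trans
          (Real.exp_le_exp.2 (hrm t))) (hdecay s z) ?_
        -- Only the jump from `s` to `z` counts, because `u` and `s` lie in the same shell.
        have hNz : N z ≤ N u + supNorm (s - z) := by
          have h1 : N s ≤ N u := by
            refine freeCount_le_of_mem_shell htT ?_ ?_
            · omega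
            · have := supNorm_sub_le s t x
              omega
          have h2 : N z ≤ N s + supNorm (s - z) := by
            refine freeCount_le_add ?_
            have h3 := supNorm_sub_le z s x
            have h4 := supNorm_sub_comm z s
            omega
          omega
        have h1 := hdrop u z _ hNz
        have h2 := hhop (supNorm (s - z)) κ hκ (by linarith)
        have hubox : (if box u then 3 * m else 0) = 3 * m := if_pos ⟨t, htT, hut⟩
        have hp := profile_nonneg hρ (Nat.cast_nonneg (α := ℝ) (supNorm (s - z)))
        have hτp := mul_nonneg hτ0 hp
        have hκg := mul_nonneg hκ hgap
        simp only [hw, hubox]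
        by_cases hzb : box z
        · obtain ⟨t', ht'T, hzt'⟩ := hzb
          have hzbox : (if box z then 3 * m else 0) = 3 * m := if_pos ⟨t', ht'T, hzt'⟩
          rw [hzbox]
          have hne : t ≠ t' := by
            rintro rfl
            exact hzt hzt'
          have h3 := hsep t htT t' ht'T hne
          have h4 := supNorm_sub_le t s t'
          have h5 := supNorm_sub_le s z t'
          have h6 := supNorm_sub_comm t s
          have h7 := hfar (supNorm (s - z)) (by omega)
          linarith
        · rw [if_neg hzb]
          linarith
    · have hgood : IsGood ρ ρ' ε φ v κ E l u := by
        by_contra hcon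
        exact hub (hcov u hu hcon)
      refine norm_greenExt_mul_weight_le (B := cube l u) (W := fun u => Real.exp (w u)) ?_
        (isUnit_det_of_isNR hφ hgood.1) hΛu (self_mem_cube l u) hy ?_ (Real.exp_pos _).le hθ0
        hM hM0 ?_
      · intro z hz
        rw [mem_cube_iff] at hz
        rw [mem_cube_iff]
        have := supNorm_sub_le z u x
        omega
      · rw [mem_cube_iff]
        intro hyt
        have := supNorm_sub_le y u x
        omega
      · intro s hs z hz
        have hsc := hs
        rw [mem_cube_iff] at hs
        rw [Finset.mem_sdiff, mem_cube_iff l u] at hz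
        obtain ⟨hzΛ, hzt⟩ := hz
        have hzu := supNorm_sub_comm z u
        have htri := supNorm_sub_le u s z
        have hsu := supNorm_sub_comm s u
        have hNz : N z ≤ N u + supNorm (u - z) := by
          refine freeCount_le_add ?_
          have h3 := supNorm_sub_le z u x
          omega
        have h1 := hdrop u z _ hNz
        have h7 := hfar (supNorm (u - z)) (by omega)
        have hsub : profile ρ (supNorm (u - z)) ≤
            profile ρ (supNorm (u - s)) + profile ρ (supNorm (s - z)) :=
          (profile_mono hρ (Nat.cast_nonneg _) (by exact_mod_cast htri)).trans
            (profile_add_le hρ (Nat.cast_nonneg _) (Nat.cast_nonneg _))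
        have hκsub := mul_le_mul_of_nonneg_left hsub hκ
        have hubox : (if box u then 3 * m else 0) = 0 := if_neg hub
        have hz3 := (hif z).2
        have hκg := mul_nonneg hκ hgap
        by_cases hsfar : (l : ℝ) ^ (4 / 5 : ℝ) < ‖s - u‖
        · have hG : ‖greenExt ε φ v (cube l u) E u s‖ ≤
              Real.exp (-κ * Real.log ((supNorm (u - s) : ℝ) + 1) ^ ρ) := by
            have h2 := hgood.2 ⟨s, hsc⟩ hsfar
            rw [← greenExt_coe, norm_eq_supNorm] at h2
            exact h2
          refine hopping_term_le hε hε₁ hG (hdecay s z) ?_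
          have h2 := hhop (supNorm (s - z)) κ hκ (by linarith)
          have h3 := mul_le_mul_of_nonneg_left
            (profile_le_add_gap hρ (Nat.cast_nonneg (α := ℝ) (supNorm (u - s)))) hκ
          simp only [hw, hubox]
          linarith
        -- No decay of the cube's Green's function is known here, but `s` is within `l/2` of `u`, so
        -- the hop to `z` is at least as long as `u - s`. As `γ ≥ 5κ`, hopping at rate `2κ` pays for
        -- both legs.
        · refine hopping_term_le hε hε₁ ((norm_greenExt_le_of_isNR hφ hgood.1 u s).trans
            (Real.exp_le_exp.2 hlm)) (hdecay s z) ?_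
          have h2 := hhop (supNorm (s - z)) (2 * κ) (by linarith) (by linarith)
          have hle : supNorm (u - s) ≤ supNorm (s - z) := by
            rw [norm_eq_supNorm] at hsfar
            have h3 : 2 * supNorm (s - u) ≤ l := by
              have : 2 * (supNorm (s - u) : ℝ) ≤ l := by linarith
              exact_mod_cast this
            omega
          have h4 := mul_le_mul_of_nonneg_left
            (profile_mono hρ (Nat.cast_nonneg _) (Nat.cast_le (α := ℝ).2 hle)) hκ
          simp only [hw, hubox]
          linarith
  have hx := hmain x (self_mem_cube L x)
  have hNx : N x = 0 := by simp [hN, freeCount, supNorm]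
  rw [← le_div_iff₀ (Real.exp_pos _), ← Real.exp_sub] at hx
  refine hx.trans (Real.exp_le_exp.2 ?_)
  simp only [hw, hNx, Nat.sub_zero]
  linarith [(hif x).2]

/-- Largeness conditions on the scales `l` and `L`. -/
structure LargeScale (d : ℕ) (ρ ρ' α κ ε₁ : ℝ) (l L : ℕ) : Prop where
  one_le : 1 ≤ l
  log_ge : 20 * ρ ≤ Real.log l
  two_rpow_le : 2 * (l : ℝ) ^ (4 / 5 : ℝ) ≤ l
  log_mul_le : Real.log (26 * l) ^ ρ' ≤ 2 * Real.log l ^ ρ'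
  profile_zero_le : κ * profile ρ 0 ≤ Real.log l ^ ρ'
  absorb : ε₁ * Real.exp (2 * κ * profileGap ρ) * (2 * (((2 * L + 1) ^ d : ℕ) : ℝ) ^ 2) ≤
    Real.exp (Real.log l ^ ρ')
  far : 500 * (l : ℝ) ≤ (L : ℝ) ^ (4 / 5 : ℝ)
  rpow_le : (l : ℝ) ^ (4 / 5 * α) ≤ 2 * (L : ℝ) ^ (4 / 5 : ℝ)
  log_le : Real.log L ≤ 2 * Real.log l

/-- Bernoulli's inequality applied to `log (t-s) / log t`, with `log (1-δ) ≥ -2δ` for `δ ≤ 1/2`. -/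
theorem log_rpow_sub_le {ρ t s : ℝ} (hρ : 1 ≤ ρ) (hs : 0 ≤ s) (hst : 2 * s ≤ t)
    (ht : 2 * ρ ≤ Real.log t) (ht0 : 0 < t) :
    Real.log t ^ ρ * (1 - 2 * ρ * (s / t) / Real.log t) ≤ Real.log (t - s) ^ ρ := by
  have hlog : 0 < Real.log t := by linarith
  have hδ : s / t ≤ 1 / 2 := by rw [div_le_div_iff₀ ht0 (by norm_num)]; linarith
  have hδ0 : 0 ≤ s / t := by positivity
  have h1 : 1 - 2 * (s / t) / Real.log t ≤ Real.log (t - s) / Real.log t := by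
    rw [one_sub_div hlog.ne', div_le_div_iff_of_pos_right hlog]
    have h2 : t - s = t * (1 - s / t) := by field_simp
    have h3 : (0:ℝ) < 1 - s / t := by linarith
    rw [h2, Real.log_mul ht0.ne' h3.ne']
    have h4 := Real.one_sub_inv_le_log_of_pos h3
    have h5 : (1 - s / t)⁻¹ ≤ 1 + 2 * (s / t) := by
      rw [inv_le_iff_one_le_mul₀ h3]
      nlinarith
    linarith
  have hη : 2 * (s / t) / Real.log t ≤ 1 := by
    rw [div_le_one hlog]
    linarith
  have h6 := one_add_mul_self_le_rpow_one_add (s := -(2 * (s / t) / Real.log t)) (by linarith) hρ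
  have h7 : (1 + -(2 * (s / t) / Real.log t)) ^ ρ ≤ (Real.log (t - s) / Real.log t) ^ ρ :=
    Real.rpow_le_rpow (by linarith) (by linarith) (by linarith)
  have hnn : 0 ≤ Real.log (t - s) := by
    have : 0 ≤ Real.log (t - s) / Real.log t := le_trans (by linarith) h1
    have := mul_nonneg this hlog.le
    rwa [div_mul_cancel₀ _ hlog.ne'] at this
  rw [Real.div_rpow hnn hlog.le, le_div_iff₀ (Real.rpow_pos_of_pos hlog _)] at h7
  have h8 := mul_le_mul_of_nonneg_right h6 (Real.rpow_pos_of_pos hlog ρ).le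
  refine le_trans (le_of_eq ?_) (h8.trans h7)
  ring

/-- Take `m = log^ρ' l` and `τ = 6/D` with `D = log^(ρ-ρ') l`. Apart from the excluded radii, the
losses in units of `F/D ≥ m` are `6` from `τ`, `3` from the penalty, `1` from `profile ρ 0` and
`2^ρ` from `log^ρ' L`, within the allowed `30 + 2^ρ`. -/
theorem isGood_of_few_bad {γ ρ ρ' α κ ε₁ ε E : ℝ} {l L : ℕ} {x : Fin d → ℤ}
    {φ : (Fin d → ℤ) → ℂ} {v : (Fin d → ℤ) → ℝ}
    (hρ' : 1 < ρ') (hρ : ρ' < ρ) (hκ : 0 < κ) (hγ : 5 * κ ≤ γ) (hφ : IsHopping γ ρ φ)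
    (hε : 0 < ε) (hε₁ : ε ≤ ε₁) (hS : LargeScale d ρ ρ' α κ ε₁ l L)
    (hmin : minRate γ ρ ρ' α l ≤ κ) (hres : ¬ HasResonance ρ' ε φ v l L E x)
    (hbad : ¬ ∃ a ∈ cube L x, ∃ b ∈ cube L x, ∃ c ∈ cube L x, ∃ e ∈ cube L x,
      ¬ IsGood ρ ρ' ε φ v κ E l a ∧ ¬ IsGood ρ ρ' ε φ v κ E l b ∧
      ¬ IsGood ρ ρ' ε φ v κ E l c ∧ ¬ IsGood ρ ρ' ε φ v κ E l e ∧
      2 * l < supNorm (b - a) ∧ 2 * l < supNorm (c - a) ∧ 2 * l < supNorm (c - b) ∧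
      2 * l < supNorm (e - a) ∧ 2 * l < supNorm (e - b) ∧ 2 * l < supNorm (e - c)) :
    IsGood ρ ρ' ε φ v (nextRate γ ρ ρ' α κ l) E L x := by
  have hρ0 : 0 < ρ := by linarith
  simp only [HasResonance, not_or, not_not, not_exists, not_and] at hres
  obtain ⟨hNR, hresz⟩ := hres
  obtain ⟨T, r, hTΛ, hTcard, hr, hsep, hcov⟩ :=
    exists_separated_cover l (cube L x) (fun z => ¬ IsGood ρ ρ' ε φ v κ E l z) hbad
  refine ⟨hNR, fun y hyfar => ?_⟩
  have hl1 := hS.one_le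
  have hl0 : (1 : ℝ) ≤ l := by exact_mod_cast hl1
  have hlog : 0 < Real.log l := by linarith [hS.log_ge]
  set m : ℝ := Real.log l ^ ρ' with hm
  have hm0 : 0 ≤ m := Real.rpow_nonneg hlog.le _
  set D : ℝ := Real.log l ^ (ρ - ρ') with hD
  have hD0 : 0 < D := Real.rpow_pos_of_pos hlog _
  have hmD : Real.log l ^ ρ = m * D := by
    rw [hm, hD, ← Real.rpow_add hlog]; congr 1; ring
  have hγ0 : 0 < γ := by linarith
  have h2ρ : (0:ℝ) < 2 ^ ρ := by positivity
  have hτκ : 6 / D ≤ κ := by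
    refine le_trans ?_ hmin
    rw [minRate, ← hD]
    have h1 : 0 ≤ γ * (11 / Real.log l ^ (ρ - 1)) := by positivity
    have h2 : 0 ≤ γ * (11 / (l : ℝ) ^ (4 / 5 * α - 1)) := by positivity
    have h3 : 6 / D ≤ (31 + 2 ^ ρ) / D := by gcongr; linarith
    linarith
  have hrle : ∀ z, r z ≤ 26 * l := fun z => by rcases hr z with h | h | h <;> omega
  have hr1 : ∀ z, 1 ≤ r z := fun z => by rcases hr z with h | h | h <;> omega
  obtain ⟨y, hy⟩ := y
  simp only at hyfar ⊢
  set R := supNorm (y - x) with hR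
  rw [norm_eq_supNorm, ← hR] at hyfar
  have hmain := norm_greenExt_center_le (τ := 6 / D) (m := m) hρ0 hκ.le hγ hφ hε hε₁
    (by positivity) hτκ hm0
    (by
      have h1 : Real.log l ^ ρ ≤ profile ρ l := by
        refine le_trans ?_ (log_rpow_le_profile hρ0 (Nat.cast_nonneg l))
        exact Real.rpow_le_rpow hlog.le (Real.log_le_log (by linarith) (by linarith)) hρ0.le
      rw [hmD] at h1
      calc 6 * m = 6 / D * (m * D) := by field_simp
        _ ≤ 6 / D * profile ρ l := by gcongr)
    hS.two_rpow_le (by rw [card_cube]; exact hS.absorb) le_rfl hNR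
    (fun z hz => by
      obtain ⟨h1, h2, h3⟩ := hresz z (hTΛ hz)
      rcases hr z with h | h | h <;> rw [h] <;> assumption)
    (fun z => by
      refine le_trans ?_ hS.log_mul_le
      have h1 : (1:ℝ) ≤ r z := by exact_mod_cast hr1 z
      have h2 : (r z : ℝ) ≤ 26 * l := by exact_mod_cast hrle z
      exact Real.rpow_le_rpow (Real.log_nonneg h1) (Real.log_le_log (by linarith) h2)
        (by linarith))
    hrle hsep hcov hy
  rw [greenExt, dif_pos ⟨self_mem_cube L x, hy⟩] at hmain
  refine hmain.trans (Real.exp_le_exp.2 ?_)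
  rw [norm_sub_rev, norm_eq_supNorm, ← hR]
  have hRl : 500 * l ≤ R := by
    have : 500 * (l : ℝ) ≤ R := hS.far.trans hyfar.le
    exact_mod_cast this
  set Q : ℕ := freeCount T (fun z => supNorm (z - x)) r (R - 60 * l) with hQ
  -- The margin and three shells give `60 + 3 * 53 = 219`.
  have hQR : R ≤ Q + 250 * l := by
    have h1 := le_freeCount_add (T := T) (c := fun z => supNorm (z - x)) (r := r) (R - 60 * l)
    have h2 : ∑ z ∈ T, (2 * r z + 1) ≤ 3 * (53 * l) := by
      calc ∑ z ∈ T, (2 * r z + 1) ≤ ∑ z ∈ T, 53 * l :=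
            Finset.sum_le_sum fun z _ => by have := hrle z; omega
        _ = T.card * (53 * l) := by rw [Finset.sum_const, smul_eq_mul]
        _ ≤ 3 * (53 * l) := Nat.mul_le_mul_right _ hTcard
    omega
  have hRlR : 500 * (l : ℝ) ≤ R := by exact_mod_cast hRl
  have hQRR : (R : ℝ) ≤ Q + 250 * l := by exact_mod_cast hQR
  have hlogR : Real.log l ≤ Real.log ((R : ℝ) + 1) :=
    Real.log_le_log (by linarith) (by linarith)
  set F : ℝ := Real.log ((R : ℝ) + 1) ^ ρ with hF
  have hF0 : 0 ≤ F := Real.rpow_nonneg (hlog.le.trans hlogR) _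
  have hFm : m * D ≤ F := by
    rw [← hmD]
    exact Real.rpow_le_rpow hlog.le hlogR hρ0.le
  have hberno := log_rpow_sub_le (ρ := ρ) (t := (R : ℝ) + 1) (s := 250 * l) (by linarith)
    (by positivity) (by linarith) (by linarith [hS.log_ge]) (by linarith)
  have hQF : Real.log ((R : ℝ) + 1 - 250 * l) ^ ρ ≤ profile ρ Q := by
    refine le_trans ?_ (log_rpow_le_profile hρ0 (Nat.cast_nonneg Q))
    refine Real.rpow_le_rpow (Real.log_nonneg (by linarith))
      (Real.log_le_log (by linarith) (by linarith)) hρ0.le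
  set P : ℝ := (l : ℝ) ^ (4 / 5 * α - 1) with hP
  have hP0 : 0 < P := by positivity
  -- the relative loss from the excluded shells
  have hloss : (κ - 6 / D) * (2 * ρ * (250 * l / ((R : ℝ) + 1)) / Real.log ((R : ℝ) + 1)) ≤
      γ * (10 / P) := by
    have h1 : l * P ≤ 2 * R := by
      have : (l : ℝ) * P = (l : ℝ) ^ (4 / 5 * α) := by
        rw [hP, Real.rpow_sub_one (by linarith)]; field_simp
      rw [this]
      linarith [hS.rpow_le]
    have hR1 : (0:ℝ) < (R : ℝ) + 1 := by positivity
    have h2 : (l : ℝ) / ((R : ℝ) + 1) ≤ 2 / P := by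
      rw [div_le_div_iff₀ hR1 hP0]; linarith
    have h3 : 2 * ρ / Real.log ((R : ℝ) + 1) ≤ 1 / 10 := by
      rw [div_le_div_iff₀ (hlog.trans_le hlogR) (by norm_num)]
      linarith [hS.log_ge]
    have h4 : κ - 6 / D ≤ γ / 5 := by
      have : 0 ≤ 6 / D := by positivity
      linarith
    have hρlog : 0 ≤ 2 * ρ / Real.log ((R : ℝ) + 1) := by
      have := hlog.trans_le hlogR
      positivity
    calc _ = (κ - 6 / D) * (250 * ((2 * ρ / Real.log ((R : ℝ) + 1)) *
          ((l : ℝ) / ((R : ℝ) + 1)))) := by ring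
      _ ≤ γ / 5 * (250 * (1 / 10 * (2 / P))) := by gcongr
      _ = γ * (10 / P) := by ring
  have hfin1 := mul_le_mul_of_nonneg_left (hberno.trans hQF) (sub_nonneg.2 hτκ)
  have hfin2 := mul_le_mul_of_nonneg_right hloss hF0
  have hFD : m ≤ F / D := by rwa [le_div_iff₀ hD0]
  have hLm : Real.log L ^ ρ' ≤ 2 ^ ρ * m := by
    have hL0 : 0 ≤ Real.log L := Real.log_natCast_nonneg L
    calc Real.log L ^ ρ' ≤ (2 * Real.log l) ^ ρ' :=
          Real.rpow_le_rpow hL0 hS.log_le (by linarith)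
      _ = 2 ^ ρ' * m := by rw [Real.mul_rpow (by norm_num) hlog.le]
      _ ≤ 2 ^ ρ * m := by
        gcongr
        norm_num
  have hLm' : 2 ^ ρ * m ≤ 2 ^ ρ * (F / D) := by gcongr
  have hpz : (κ - 6 / D) * profile ρ 0 ≤ m := by
    refine le_trans ?_ hS.profile_zero_le
    have := profile_nonneg hρ0 (le_refl (0:ℝ))
    have h6 : 0 ≤ 6 / D := by positivity
    nlinarith
  have hneg : 0 ≤ γ * (10 / Real.log l ^ (ρ - 1)) * F := by positivity
  rw [nextRate, ← hP, ← hD]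
  have e1 : (6 / D) * F = 6 * (F / D) := by ring
  have e2 : (30 + 2 ^ ρ) / D * F = 30 * (F / D) + 2 ^ ρ * (F / D) := by ring
  rw [← hF] at hfin1
  have e3 : -(κ - (γ * (10 / P) + γ * (10 / Real.log l ^ (ρ - 1)) + (30 + 2 ^ ρ) / D)) * F =
      -(κ * F) + γ * (10 / P) * F + γ * (10 / Real.log l ^ (ρ - 1)) * F +
        (30 + 2 ^ ρ) / D * F := by ring
  rw [e3, e2]
  have e4 : (κ - 6 / D) * (F * (1 - 2 * ρ * (250 * l / ((R : ℝ) + 1)) /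
      Real.log ((R : ℝ) + 1))) = κ * F - 6 * (F / D) -
      (κ - 6 / D) * (2 * ρ * (250 * l / ((R : ℝ) + 1)) / Real.log ((R : ℝ) + 1)) * F := by
    rw [← e1]; ring
  rw [e4] at hfin1
  linarith

/-! ### Bad events are open, and independent for disjoint cubes -/

theorem isGood_congr {ρ ρ' ε κ E : ℝ} {φ : (Fin d → ℤ) → ℂ} {v v' : (Fin d → ℤ) → ℝ} {L : ℕ}
    {x : Fin d → ℤ} (h : ∀ z ∈ cube L x, v z = v' z) :
    IsGood ρ ρ' ε φ v κ E L x ↔ IsGood ρ ρ' ε φ v' κ E L x := by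
  have hr : restrict ε φ v (cube L x) = restrict ε φ v' (cube L x) := by
    ext i j
    simp only [restrict, Matrix.of_apply, kernel, h i i.2]
  simp only [IsGood, IsNR, green, hr]

/-- Where non-resonance holds the determinant is nonzero, so the bound on the inverse can be cleared
to one on the adjugate, which is continuous in `v` everywhere. -/
theorem isClosed_isGood {γ ρ ρ' ε κ E : ℝ} {φ : (Fin d → ℤ) → ℂ} (hφ : IsHopping γ ρ φ) (L : ℕ)
    (x : Fin d → ℤ) :
    IsClosed {v : (Fin d → ℤ) → ℝ | IsGood ρ ρ' ε φ v κ E L x} := by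
  set A : ((Fin d → ℤ) → ℝ) → Matrix (cube L x) (cube L x) ℂ := fun v =>
    restrict ε φ v (cube L x) - (E : ℂ) • (1 : Matrix (cube L x) (cube L x) ℂ) with hA
  have hcont : Continuous A := by
    refine Continuous.sub ?_ continuous_const
    refine continuous_matrix fun i j => ?_
    simp only [restrict, Matrix.of_apply, kernel]
    refine continuous_const.add ?_
    by_cases h : (i : Fin d → ℤ) = j
    · simp only [h, if_true]
      exact Complex.continuous_ofReal.comp (continuous_apply _)
    · simp only [h, if_false]
      exact continuous_const
  have hset : {v : (Fin d → ℤ) → ℝ | IsGood ρ ρ' ε φ v κ E L x} =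
      (⋂ ψ : cube L x → ℂ, {v | Real.exp (-(Real.log L ^ ρ')) * ‖WithLp.toLp 2 ψ‖ ≤
        ‖WithLp.toLp 2 ((A v).mulVec ψ)‖}) ∩
      ⋂ y : cube L x, ⋂ _ : (L : ℝ) ^ (4 / 5 : ℝ) < ‖(y : Fin d → ℤ) - x‖,
        {v | ‖(A v).adjugate ⟨x, self_mem_cube L x⟩ y‖ ≤
          Real.exp (-κ * Real.log (‖x - (y : Fin d → ℤ)‖ + 1) ^ ρ) * ‖(A v).det‖} := by
    ext v
    simp only [Set.mem_inter_iff, Set.mem_iInter, Set.mem_ofPred_eq, IsGood]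
    rw [isNR_iff ε φ v hφ]
    refine and_congr_right fun hNR => ?_
    have hu := isUnit_det_of_mulVec_bound (Real.exp_pos _) hNR
    refine forall_congr' fun y => imp_congr_right fun _ => ?_
    have hdet : 0 < ‖(A v).det‖ := norm_pos_iff.2 hu.ne_zero
    rw [green, Matrix.inv_def, Matrix.smul_apply, smul_eq_mul, norm_mul, Ring.inverse_eq_inv',
      norm_inv, inv_mul_le_iff₀ hdet, mul_comm]
  rw [hset]
  refine IsClosed.inter (isClosed_iInter fun ψ => ?_)
    (isClosed_iInter fun y => isClosed_iInter fun _ => ?_)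
  · refine isClosed_le continuous_const (Continuous.norm ?_)
    exact (PiLp.continuous_toLp 2 _).comp (hcont.matrix_mulVec continuous_const)
  · refine isClosed_le (Continuous.norm ?_) (continuous_const.mul hcont.matrix_det.norm)
    exact hcont.matrix_adjugate.matrix_elem _ _

/-- The potentials for which the cubes of radius `l` at `a` and `b` are both bad at some energy. -/
def badPair (ρ ρ' ε : ℝ) (φ : (Fin d → ℤ) → ℂ) (κ : ℝ) (I : Set ℝ) (l : ℕ)
    (a b : Fin d → ℤ) : Set ((Fin d → ℤ) → ℝ) :=
  {v | ∃ E ∈ I, ¬ IsGood ρ ρ' ε φ v κ E l a ∧ ¬ IsGood ρ ρ' ε φ v κ E l b}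

theorem isOpen_badPair {γ ρ ρ' ε κ : ℝ} {φ : (Fin d → ℤ) → ℂ} (hφ : IsHopping γ ρ φ)
    (I : Set ℝ) (l : ℕ) (a b : Fin d → ℤ) : IsOpen (badPair ρ ρ' ε φ κ I l a b) := by
  have : badPair ρ ρ' ε φ κ I l a b = ⋃ E ∈ I,
      {v | IsGood ρ ρ' ε φ v κ E l a}ᶜ ∩ {v | IsGood ρ ρ' ε φ v κ E l b}ᶜ := by
    ext v
    simp only [badPair, Set.mem_ofPred_eq, Set.mem_iUnion, Set.mem_inter_iff, Set.mem_compl_iff,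
      exists_prop]
  rw [this]
  exact isOpen_biUnion fun E _ =>
    (isClosed_isGood hφ l a).isOpen_compl.inter (isClosed_isGood hφ l b).isOpen_compl

theorem badPair_congr {ρ ρ' ε κ : ℝ} {φ : (Fin d → ℤ) → ℂ} {I : Set ℝ} {l : ℕ}
    {a b : Fin d → ℤ} {v v' : (Fin d → ℤ) → ℝ} (h : ∀ z ∈ cube l a ∪ cube l b, v z = v' z) :
    v ∈ badPair ρ ρ' ε φ κ I l a b ↔ v' ∈ badPair ρ ρ' ε φ κ I l a b := by
  have ha : ∀ z ∈ cube l a, v z = v' z := fun z hz => h z (Finset.mem_union_left _ hz)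
  have hb : ∀ z ∈ cube l b, v z = v' z := fun z hz => h z (Finset.mem_union_right _ hz)
  simp only [badPair, Set.mem_ofPred_eq, isGood_congr ha, isGood_congr hb]

section Probability

open MeasureTheory ProbabilityTheory

variable {Ω : Type*} [MeasurableSpace Ω] {P : Measure Ω}

/-- Extension by zero from the finite support is continuous, so each event is the preimage of an
open set of finitely many coordinates. -/
theorem measureReal_inter_of_disjoint_support {ι : Type*} [DecidableEq ι]
    {V : ι → Ω → ℝ} (hV : ∀ x, Measurable (V x)) (hind : iIndepFun V P)
    {S T : Finset ι} (hST : Disjoint S T) {U W : Set (ι → ℝ)}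
    (hU : IsOpen U) (hW : IsOpen W)
    (hUS : ∀ v v' : ι → ℝ, (∀ z ∈ S, v z = v' z) → (v ∈ U ↔ v' ∈ U))
    (hWT : ∀ v v' : ι → ℝ, (∀ z ∈ T, v z = v' z) → (v ∈ W ↔ v' ∈ W)) :
    P.real {ω | (fun z => V z ω) ∈ U ∧ (fun z => V z ω) ∈ W} =
      P.real {ω | (fun z => V z ω) ∈ U} * P.real {ω | (fun z => V z ω) ∈ W} := by
  have key : ∀ (S : Finset ι) (U : Set (ι → ℝ)), IsOpen U →
      (∀ v v' : ι → ℝ, (∀ z ∈ S, v z = v' z) → (v ∈ U ↔ v' ∈ U)) →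
      ∃ U' : Set (S → ℝ), MeasurableSet U' ∧
        {ω | (fun z => V z ω) ∈ U} = (fun ω (i : S) => V i ω) ⁻¹' U' := by
    intro S U hU hUS
    set e : (S → ℝ) → ι → ℝ := fun u z => if h : z ∈ S then u ⟨z, h⟩ else 0 with he
    have hec : Continuous e := by
      refine continuous_pi fun z => ?_
      by_cases h : z ∈ S
      · simp only [he, h, dif_pos]
        exact continuous_apply _
      · simp only [he, h, dif_neg, not_false_eq_true]
        exact continuous_const
    refine ⟨e ⁻¹' U, (hU.preimage hec).measurableSet, ?_⟩
    ext ω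
    simp only [Set.mem_ofPred_eq, Set.mem_preimage]
    refine hUS _ _ fun z hz => ?_
    simp [he, hz]
  obtain ⟨U', hU', hUe⟩ := key S U hU hUS
  obtain ⟨W', hW', hWe⟩ := key T W hW hWT
  have h := (hind.indepFun_finset S T hST hV).measure_inter_preimage_eq_mul U' W' hU' hW'
  have hset : {ω | (fun z => V z ω) ∈ U ∧ (fun z => V z ω) ∈ W} =
      (fun ω (i : S) => V i ω) ⁻¹' U' ∩ (fun ω (i : T) => V i ω) ⁻¹' W' := by
    rw [← hUe, ← hWe]
    rfl
  rw [hset, hUe, hWe, measureReal_def, h, ENNReal.toReal_mul]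
  rfl

theorem disjoint_cube {l : ℕ} {a b : Fin d → ℤ} (h : 2 * l < supNorm (b - a)) :
    Disjoint (cube l a) (cube l b) := by
  rw [Finset.disjoint_left]
  intro z hza hzb
  rw [mem_cube_iff] at hza hzb
  have h1 := supNorm_sub_le b z a
  have h2 := supNorm_sub_comm b z
  omega

/-- The potentials for which four pairwise distant cubes of radius `l` with centres in `B_L(x)`
are bad at a common energy. -/
def fourBad (ρ ρ' ε : ℝ) (φ : (Fin d → ℤ) → ℂ) (κ : ℝ) (I : Set ℝ) (l L : ℕ)
    (x : Fin d → ℤ) : Set ((Fin d → ℤ) → ℝ) :=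
  {v | ∃ E ∈ I, ∃ a ∈ cube L x, ∃ b ∈ cube L x, ∃ c ∈ cube L x, ∃ e ∈ cube L x,
      ¬ IsGood ρ ρ' ε φ v κ E l a ∧ ¬ IsGood ρ ρ' ε φ v κ E l b ∧
      ¬ IsGood ρ ρ' ε φ v κ E l c ∧ ¬ IsGood ρ ρ' ε φ v κ E l e ∧
      2 * l < supNorm (b - a) ∧ 2 * l < supNorm (c - a) ∧ 2 * l < supNorm (c - b) ∧
      2 * l < supNorm (e - a) ∧ 2 * l < supNorm (e - b) ∧ 2 * l < supNorm (e - c)}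

/-- Keeping the common energy only within each pair decouples the pairs; the factor counts
quadruples of centres. -/
theorem measureReal_fourBad_le [IsProbabilityMeasure P] {γ ρ ρ' ε κ q : ℝ} {φ : (Fin d → ℤ) → ℂ} {I : Set ℝ} {l L : ℕ}
    {V : (Fin d → ℤ) → Ω → ℝ} (hV : ∀ x, Measurable (V x)) (hind : iIndepFun V P)
    (hφ : IsHopping γ ρ φ)
    (hpair : ∀ a b : Fin d → ℤ, 2 * l < supNorm (b - a) →
      P.real {ω | (fun z => V z ω) ∈ badPair ρ ρ' ε φ κ I l a b} ≤ q) (x : Fin d → ℤ) :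
    P.real {ω | (fun z => V z ω) ∈ fourBad ρ ρ' ε φ κ I l L x} ≤
      ((((2 * L + 1) ^ d : ℕ) : ℝ)) ^ 4 * q ^ 2 := by
  classical
  set Λ := cube L x with hΛ
  set ev : ((Fin d → ℤ) × (Fin d → ℤ)) × ((Fin d → ℤ) × (Fin d → ℤ)) → Set Ω := fun s =>
    {ω | ((fun z => V z ω) ∈ badPair ρ ρ' ε φ κ I l s.1.1 s.1.2 ∧
      (fun z => V z ω) ∈ badPair ρ ρ' ε φ κ I l s.2.1 s.2.2) ∧
      2 * l < supNorm (s.1.2 - s.1.1) ∧ 2 * l < supNorm (s.2.1 - s.1.1) ∧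
      2 * l < supNorm (s.2.1 - s.1.2) ∧ 2 * l < supNorm (s.2.2 - s.1.1) ∧
      2 * l < supNorm (s.2.2 - s.1.2) ∧ 2 * l < supNorm (s.2.2 - s.2.1)} with hev
  have hsub : {ω | (fun z => V z ω) ∈ fourBad ρ ρ' ε φ κ I l L x} ⊆
      ⋃ s ∈ (Λ ×ˢ Λ) ×ˢ (Λ ×ˢ Λ), ev s := by
    rintro ω ⟨E, hE, a, ha, b, hb, c, hc, e, he, ba, bb, bc, be, h⟩
    simp only [Set.mem_iUnion]
    refine ⟨((a, b), (c, e)), ?_, ⟨⟨E, hE, ba, bb⟩, ⟨E, hE, bc, be⟩⟩, h⟩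
    simp only [Finset.mem_product]
    exact ⟨⟨ha, hb⟩, ⟨hc, he⟩⟩
  have hone : ∀ s, P.real (ev s) ≤ q ^ 2 := by
    rintro ⟨⟨a, b⟩, ⟨c, e⟩⟩
    by_cases hsep : 2 * l < supNorm (b - a) ∧ 2 * l < supNorm (c - a) ∧
        2 * l < supNorm (c - b) ∧ 2 * l < supNorm (e - a) ∧
        2 * l < supNorm (e - b) ∧ 2 * l < supNorm (e - c)
    · have hset : ev ((a, b), (c, e)) =
          {ω | (fun z => V z ω) ∈ badPair ρ ρ' ε φ κ I l a b ∧
            (fun z => V z ω) ∈ badPair ρ ρ' ε φ κ I l c e} := by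
        ext ω
        simp only [hev, Set.mem_ofPred_eq, hsep, and_true]
      obtain ⟨hab, hac, hbc, hae, hbe, hce⟩ := hsep
      have hdisj : Disjoint (cube l a ∪ cube l b) (cube l c ∪ cube l e) := by
        rw [Finset.disjoint_union_left, Finset.disjoint_union_right, Finset.disjoint_union_right]
        exact ⟨⟨disjoint_cube hac, disjoint_cube hae⟩, disjoint_cube hbc, disjoint_cube hbe⟩
      rw [hset, measureReal_inter_of_disjoint_support hV hind hdisj (isOpen_badPair hφ I l a b)
        (isOpen_badPair hφ I l c e) (fun _ _ h => badPair_congr h) (fun _ _ h => badPair_congr h),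
        sq]
      exact mul_le_mul (hpair a b hab) (hpair c e hce) measureReal_nonneg
        (measureReal_nonneg.trans (hpair a b hab))
    · have hset : ev ((a, b), (c, e)) = ∅ := by
        ext ω
        simp only [hev, Set.mem_ofPred_eq, hsep, and_false, Set.mem_empty_iff_false]
      rw [hset, measureReal_empty]
      positivity
  calc P.real {ω | (fun z => V z ω) ∈ fourBad ρ ρ' ε φ κ I l L x}
      ≤ P.real (⋃ s ∈ (Λ ×ˢ Λ) ×ˢ (Λ ×ˢ Λ), ev s) :=
        measureReal_mono hsub (measure_ne_top P _)
    _ ≤ ∑ s ∈ (Λ ×ˢ Λ) ×ˢ (Λ ×ˢ Λ), P.real (ev s) := measureReal_biUnion_finset_le _ _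
    _ ≤ ∑ s ∈ (Λ ×ˢ Λ) ×ˢ (Λ ×ˢ Λ), q ^ 2 := Finset.sum_le_sum fun s _ => hone s
    _ = ((((2 * L + 1) ^ d : ℕ) : ℝ)) ^ 4 * q ^ 2 := by
      rw [Finset.sum_const, Finset.card_product, Finset.card_product, hΛ, card_cube, nsmul_eq_mul]
      push_cast
      ring

end Probability

/-! ### Large scales -/

section Scales

open Filter Topology

theorem tendsto_log_natCast_atTop : Tendsto (fun l : ℕ => Real.log l) atTop atTop :=
  Real.tendsto_log_atTop.comp tendsto_natCast_atTop_atTop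

theorem tendsto_natCast_rpow_atTop {s : ℝ} (hs : 0 < s) :
    Tendsto (fun l : ℕ => (l : ℝ) ^ s) atTop atTop :=
  (tendsto_rpow_atTop hs).comp tendsto_natCast_atTop_atTop

theorem tendsto_log_natCast_rpow_atTop {s : ℝ} (hs : 0 < s) :
    Tendsto (fun l : ℕ => Real.log l ^ s) atTop atTop :=
  (tendsto_rpow_atTop hs).comp tendsto_log_natCast_atTop

theorem eventually_half_le_floor_rpow {α : ℝ} (hα : 0 < α) :
    ∀ᶠ l : ℕ in atTop, (l : ℝ) ^ α ≤ 2 * (⌊(l : ℝ) ^ α⌋₊ : ℝ) ∧ 1 ≤ ⌊(l : ℝ) ^ α⌋₊ := by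
  filter_upwards [(tendsto_natCast_rpow_atTop hα).eventually_ge_atTop 2] with l hl
  have h1 := Nat.lt_floor_add_one ((l : ℝ) ^ α)
  refine ⟨by linarith, Nat.le_floor (by norm_num; linarith)⟩

/-- `α > 5/4` makes `L^{4/5}` dominate `l`, and `α < 2` gives `L ≤ l^2`. Nothing involves `γ`, so
neither does `l₀`. -/
theorem eventually_largeScale (d : ℕ) {ρ ρ' α : ℝ} (κ ε₁ : ℝ) (hρ' : 1 < ρ')
    (hα : 5 / 4 < α) (hα2 : α < 2) :
    ∀ᶠ l : ℕ in atTop, LargeScale d ρ ρ' α κ ε₁ l ⌊(l : ℝ) ^ α⌋₊ := by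
  have hc : (1:ℝ) < 2 ^ ρ'⁻¹ := Real.one_lt_rpow (by norm_num) (inv_pos.2 (by linarith))
  set K : ℝ := ε₁ * Real.exp (2 * κ * profileGap ρ) with hK
  filter_upwards [eventually_ge_atTop 1,
    tendsto_log_natCast_atTop.eventually_ge_atTop (20 * ρ),
    -- This threshold says `log (26l) ≤ 2^(1/ρ') log l`.
    tendsto_log_natCast_atTop.eventually_ge_atTop (Real.log 26 / (2 ^ ρ'⁻¹ - 1)),
    tendsto_log_natCast_atTop.eventually_gt_atTop 0,
    (tendsto_natCast_rpow_atTop (s := 1 / 5) (by norm_num)).eventually_ge_atTop 2,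
    (tendsto_log_natCast_rpow_atTop (s := ρ') (by linarith)).eventually_ge_atTop
      (κ * profile ρ 0),
    (tendsto_log_natCast_rpow_atTop (s := ρ' - 1) (by linarith)).eventually_ge_atTop
      (4 * d + 1 : ℝ),
    tendsto_natCast_atTop_atTop.eventually_ge_atTop (2 * |K| * 9 ^ d : ℝ),
    (tendsto_natCast_rpow_atTop (s := 4 / 5 * α - 1) (by linarith)).eventually_ge_atTop 1000,
    eventually_half_le_floor_rpow (α := α) (by linarith)] with
    l h1 hlog20 hlog26 hlog h15 hpz hlogd hKl hP hfl
  obtain ⟨hfl, hL1⟩ := hfl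
  have hl1 : (1:ℝ) ≤ l := by exact_mod_cast h1
  have hl0 : (0:ℝ) < l := by linarith
  set L := ⌊(l : ℝ) ^ α⌋₊ with hL
  have hL1' : (1:ℝ) ≤ L := by exact_mod_cast hL1
  have hLle : (L : ℝ) ≤ (l : ℝ) ^ (2:ℕ) := by
    refine (Nat.floor_le (by positivity)).trans ?_
    rw [← Real.rpow_natCast]
    exact Real.rpow_le_rpow_of_exponent_le hl1 (by norm_num; linarith)
  have hrpow : (l : ℝ) ^ (4 / 5 * α) ≤ 2 * (L : ℝ) ^ (4 / 5 : ℝ) := by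
    calc (l : ℝ) ^ (4 / 5 * α) = ((l : ℝ) ^ α) ^ (4 / 5 : ℝ) := by
          rw [← Real.rpow_mul hl0.le, mul_comm]
      _ ≤ (2 * (L : ℝ)) ^ (4 / 5 : ℝ) := by gcongr
      _ = 2 ^ (4 / 5 : ℝ) * (L : ℝ) ^ (4 / 5 : ℝ) := by
          rw [Real.mul_rpow (by norm_num) (by linarith)]
      _ ≤ 2 * (L : ℝ) ^ (4 / 5 : ℝ) := by
          gcongr
          calc (2:ℝ) ^ (4 / 5 : ℝ) ≤ 2 ^ (1:ℝ) :=
                Real.rpow_le_rpow_of_exponent_le (by norm_num) (by norm_num)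
            _ = 2 := Real.rpow_one 2
  refine ⟨h1, hlog20, ?_, ?_, hpz, ?_, ?_, hrpow, ?_⟩
  · have : (l : ℝ) = (l : ℝ) ^ (4 / 5 : ℝ) * (l : ℝ) ^ (1 / 5 : ℝ) := by
      rw [← Real.rpow_add hl0]; norm_num
    have h2 : 0 ≤ (l : ℝ) ^ (4 / 5 : ℝ) := by positivity
    nlinarith
  · rw [div_le_iff₀ (by linarith)] at hlog26
    have h2 : Real.log (26 * l) ≤ 2 ^ ρ'⁻¹ * Real.log l := by
      rw [Real.log_mul (by norm_num) hl0.ne']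
      linarith
    calc Real.log (26 * l) ^ ρ' ≤ (2 ^ ρ'⁻¹ * Real.log l) ^ ρ' :=
          Real.rpow_le_rpow (Real.log_nonneg (by linarith)) h2 (by linarith)
      _ = 2 * Real.log l ^ ρ' := by
          rw [Real.mul_rpow (by positivity) hlog.le, ← Real.rpow_mul (by norm_num),
            inv_mul_cancel₀ (by linarith), Real.rpow_one]
  · have h2 : (2 * (L : ℝ) + 1) ≤ 3 * (l : ℝ) ^ 2 := by linarith
    have h3 : (l : ℝ) ^ (4 * d + 1) ≤ Real.exp (Real.log l ^ ρ') := by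
      have h4 : Real.log l ^ ρ' = Real.log l ^ (ρ' - 1) * Real.log l := by
        rw [← Real.rpow_add_one hlog.ne']; congr 1; ring
      rw [h4, ← Real.exp_log (pow_pos hl0 _), Real.log_pow]
      refine Real.exp_le_exp.2 ?_
      push_cast
      gcongr
    refine le_trans ?_ h3
    push_cast
    calc K * (2 * ((2 * (L : ℝ) + 1) ^ d) ^ 2) ≤ |K| * (2 * ((3 * (l : ℝ) ^ 2) ^ d) ^ 2) := by
          gcongr
          exact le_abs_self K
      _ = (2 * |K| * 9 ^ d) * (l : ℝ) ^ (4 * d) := by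
          rw [mul_pow, mul_pow, ← pow_mul, ← pow_mul, ← pow_mul, mul_comm d 2, pow_mul (3:ℝ) 2 d]
          norm_num
          rw [show 2 * (2 * d) = 4 * d by ring]
          ring
      _ ≤ l * (l : ℝ) ^ (4 * d) := by gcongr
      _ = (l : ℝ) ^ (4 * d + 1) := by ring
  · have h2 : (l : ℝ) ^ (4 / 5 * α) = l * (l : ℝ) ^ (4 / 5 * α - 1) := by
      rw [Real.rpow_sub_one hl0.ne']; field_simp
    nlinarith
  · have := Real.log_le_log (by linarith) hLle
    rwa [Real.log_pow] at this

/-- The bound on `α` is exactly `α(4d + 2p) < 4p`, leaving a positive power of `l` to absorb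
constants. -/
theorem eventually_count_le {d : ℕ} {p α : ℝ} (hp : 0 < p) (hα : 0 < α)
    (hα' : α < 2 * p / (p + 2 * d)) :
    ∀ᶠ l : ℕ in atTop,
      (((2 * ⌊(l : ℝ) ^ α⌋₊ + 1) ^ d : ℕ) : ℝ) ^ 4 * ((l : ℝ) ^ (-2 * p)) ^ 2 ≤
        3 / 8 * (⌊(l : ℝ) ^ α⌋₊ : ℝ) ^ (-2 * p) := by
  have hs : 0 < 4 * p - α * (4 * d + 2 * p) := by
    rw [lt_div_iff₀ (by positivity)] at hα'
    linarith
  filter_upwards [eventually_ge_atTop 1, eventually_half_le_floor_rpow hα,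
    (tendsto_natCast_rpow_atTop hs).eventually_ge_atTop (8 / 3 * 81 ^ d)] with l h1 hfl hbig
  have hl1 : (1:ℝ) ≤ l := by exact_mod_cast h1
  have hl0 : (0:ℝ) < l := by linarith
  have hL1 : (1:ℝ) ≤ (⌊(l : ℝ) ^ α⌋₊ : ℝ) := by exact_mod_cast hfl.2
  have hLle : (⌊(l : ℝ) ^ α⌋₊ : ℝ) ≤ (l : ℝ) ^ α := Nat.floor_le (by positivity)
  push_cast
  set L : ℝ := (⌊(l : ℝ) ^ α⌋₊ : ℝ) with hL
  have hL0 : 0 < L := by linarith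
  have e1 : ((l : ℝ) ^ (-2 * p)) ^ 2 = (l : ℝ) ^ (-(4 * p)) := by
    rw [← Real.rpow_natCast, ← Real.rpow_mul hl0.le]; congr 1; push_cast; ring
  have e2 : L ^ (4 * d) * L ^ (2 * p) ≤ (l : ℝ) ^ (α * (4 * d + 2 * p)) := by
    rw [← Real.rpow_natCast, ← Real.rpow_add hL0, Real.rpow_mul hl0.le]
    push_cast
    gcongr
  have e3 : L ^ (2 * p) * L ^ (-2 * p) = 1 := by
    rw [← Real.rpow_add hL0]
    norm_num
  have e4 : (l : ℝ) ^ (4 * p - α * (4 * d + 2 * p)) * (l : ℝ) ^ (α * (4 * d + 2 * p)) *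
      (l : ℝ) ^ (-(4 * p)) = 1 := by
    rw [← Real.rpow_add hl0, ← Real.rpow_add hl0]
    ring_nf
    exact Real.rpow_zero _
  have hA : 0 ≤ (l : ℝ) ^ (-(4 * p)) := by positivity
  have hB : 0 ≤ L ^ (-2 * p) := by positivity
  rw [e1]
  have h2 : 2 * L + 1 ≤ 3 * L := by linarith
  calc ((2 * L + 1) ^ d) ^ 4 * (l : ℝ) ^ (-(4 * p))
      ≤ ((3 * L) ^ d) ^ 4 * (l : ℝ) ^ (-(4 * p)) := by gcongr
    _ = 81 ^ d * L ^ (4 * d) * (l : ℝ) ^ (-(4 * p)) * (L ^ (2 * p) * L ^ (-2 * p)) := by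
      rw [e3, mul_one, mul_pow, mul_pow, ← pow_mul, ← pow_mul, mul_comm d 4, pow_mul (3:ℝ) 4 d]
      norm_num
    _ = 3 / 8 * (8 / 3 * 81 ^ d) * (L ^ (4 * d) * L ^ (2 * p)) * (l : ℝ) ^ (-(4 * p)) *
        L ^ (-2 * p) := by ring
    _ ≤ 3 / 8 * (l : ℝ) ^ (4 * p - α * (4 * d + 2 * p)) * (l : ℝ) ^ (α * (4 * d + 2 * p)) *
        (l : ℝ) ^ (-(4 * p)) * L ^ (-2 * p) := by gcongr
    _ = 3 / 8 * ((l : ℝ) ^ (4 * p - α * (4 * d + 2 * p)) * (l : ℝ) ^ (α * (4 * d + 2 * p)) *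
        (l : ℝ) ^ (-(4 * p))) * L ^ (-2 * p) := by ring
    _ = 3 / 8 * L ^ (-2 * p) := by rw [e4, mul_one]

theorem tendsto_rate {ρ ρ' α : ℝ} (γ a b : ℝ) (hρ' : 1 < ρ') (hρ : ρ' < ρ) (hα : 5 / 4 < α) :
    Tendsto (fun l : ℕ => γ * (a / Real.log l ^ (ρ - 1)) +
      γ * (a / (l : ℝ) ^ (4 / 5 * α - 1)) + b / Real.log l ^ (ρ - ρ')) atTop (𝓝 0) := by
  have h1 := ((tendsto_log_natCast_rpow_atTop (s := ρ - 1) (by linarith)).const_div_atTop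
    a).const_mul γ
  have h2 := ((tendsto_natCast_rpow_atTop (s := 4 / 5 * α - 1) (by linarith)).const_div_atTop
    a).const_mul γ
  have h3 := (tendsto_log_natCast_rpow_atTop (s := ρ - ρ') (by linarith)).const_div_atTop b
  simpa using (h1.add h2).add h3

/-- The left side tends to `0` and the right to `κ`, so `κ/2` eventually separates them, from a
threshold depending on `γ`. -/
theorem eventually_minRate_le_nextRate {γ ρ ρ' α κ : ℝ} (hρ' : 1 < ρ') (hρ : ρ' < ρ)
    (hα : 5 / 4 < α) (hκ : 0 < κ) :
    ∀ᶠ l : ℕ in atTop, minRate γ ρ ρ' α ⌊(l : ℝ) ^ α⌋₊ ≤ nextRate γ ρ ρ' α κ l := by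
  have hfloor : Tendsto (fun l : ℕ => ⌊(l : ℝ) ^ α⌋₊) atTop atTop :=
    tendsto_nat_floor_atTop.comp (tendsto_natCast_rpow_atTop (by linarith))
  have h1 := ((tendsto_rate γ 11 (31 + 2 ^ ρ) hρ' hρ hα).comp hfloor).eventually_le_const
    (show (0:ℝ) < κ / 2 by linarith)
  have h2 := (tendsto_rate γ 10 (30 + 2 ^ ρ) hρ' hρ hα).eventually_le_const
    (show (0:ℝ) < κ / 2 by linarith)
  filter_upwards [h1, h2] with l h1 h2
  simp only [Function.comp] at h1
  rw [minRate, nextRate]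
  linarith

theorem nextRate_pos {γ ρ ρ' α κ : ℝ} {l : ℕ} (hγ : 0 < γ) (hlog : 0 < Real.log l)
    (hl : 0 < l) (hmin : minRate γ ρ ρ' α l ≤ κ) : 0 < nextRate γ ρ ρ' α κ l := by
  have hl0 : (0:ℝ) < l := by exact_mod_cast hl
  rw [minRate] at hmin
  rw [nextRate]
  have h1 : γ * (10 / Real.log l ^ (ρ - 1)) < γ * (11 / Real.log l ^ (ρ - 1)) := by
    gcongr
    norm_num
  have h2 : γ * (10 / (l : ℝ) ^ (4 / 5 * α - 1)) < γ * (11 / (l : ℝ) ^ (4 / 5 * α - 1)) := by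
    gcongr
    norm_num
  have h3 : (30 + 2 ^ ρ) / Real.log l ^ (ρ - ρ') < (31 + 2 ^ ρ) / Real.log l ^ (ρ - ρ') := by
    gcongr
    norm_num
  linarith

theorem nextRate_lt {γ ρ ρ' α κ : ℝ} {l : ℕ} (hγ : 0 < γ) (hlog : 0 < Real.log l) (hl : 0 < l) :
    nextRate γ ρ ρ' α κ l < κ := by
  have hl0 : (0:ℝ) < l := by exact_mod_cast hl
  rw [nextRate, sub_lt_self_iff]
  positivity

/-- For `α ≤ 5/4` the rate `m(l)` exceeds `11 γ`. -/
theorem lt_minRate_of_le {γ ρ ρ' α κ : ℝ} {l : ℕ} (hα : α ≤ 5 / 4) (hγ : 0 < γ)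
    (hκ : κ ≤ γ / 5) (hl : 1 ≤ l) : κ < minRate γ ρ ρ' α l := by
  have hl1 : (1:ℝ) ≤ l := by exact_mod_cast hl
  have hlog : 0 ≤ Real.log l := Real.log_nonneg hl1
  rw [minRate]
  have h1 : 0 ≤ γ * (11 / Real.log l ^ (ρ - 1)) := by positivity
  have h2 : 0 ≤ (31 + 2 ^ ρ) / Real.log l ^ (ρ - ρ') := by positivity
  have h3 : (l : ℝ) ^ (4 / 5 * α - 1) ≤ 1 :=
    Real.rpow_le_one_of_one_le_of_nonpos hl1 (by linarith)
  have h4 : (11:ℝ) ≤ 11 / (l : ℝ) ^ (4 / 5 * α - 1) := by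
    rw [le_div_iff₀ (by positivity)]
    linarith
  have h5 := mul_le_mul_of_nonneg_left h4 hγ.le
  linarith

end Scales

end MSA

/-! ### The induction step from scale `l` to scale `L` -/

theorem theorem3p1 (d : ℕ) (hd : 1 ≤ d) (ρ ρ' p α κ ε₁ : ℝ)
    (hρ' : 1 < ρ') (hρ : ρ' < ρ) (hp : 5 * (d : ℝ) < p)
    (hα : 4 / 5 < α) (hα' : α < 2 * p / (p + 2 * d)) (hκ : 0 < κ) (hε₁ : 0 < ε₁) :
    ∃ l₀ : ℝ, 0 < l₀ ∧ ∀ γ : ℝ, 0 < γ → ∃ l₁ : ℝ, 0 < l₁ ∧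
      ∀ (κ₀ : ℝ), κ ≤ κ₀ → κ₀ ≤ γ / 5 →
      ∀ (Ω : Type*) [MeasurableSpace Ω] (P : MeasureTheory.Measure Ω)
        [MeasureTheory.IsProbabilityMeasure P]
        (V : (Fin d → ℤ) → Ω → ℝ) (φ : (Fin d → ℤ) → ℂ) (ε : ℝ) (I : Set ℝ) (l L : ℕ),
      (∀ x, Measurable (V x)) → ProbabilityTheory.iIndepFun V P →
      (∀ x, ProbabilityTheory.IdentDistrib (V x) (V 0) P P) →
      MSA.IsHopping γ ρ φ → 0 < ε → ε ≤ ε₁ →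
      L = ⌊(l : ℝ) ^ α⌋₊ → l₀ ≤ l →
      MSA.minRate γ ρ ρ' α l ≤ κ →
      (∀ x y : Fin d → ℤ, 2 * (l : ℝ) < ‖x - y‖ →
        P.real {ω | ∃ E ∈ I, ¬ MSA.IsGood ρ ρ' ε φ (fun z => V z ω) κ E l x ∧
          ¬ MSA.IsGood ρ ρ' ε φ (fun z => V z ω) κ E l y} ≤ (l : ℝ) ^ (-2 * p)) →
      (∀ x y : Fin d → ℤ, 2 * (L : ℝ) < ‖x - y‖ →
        P.real {ω | ∃ E ∈ I, MSA.HasResonance ρ' ε φ (fun z => V z ω) l L E x ∧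
          MSA.HasResonance ρ' ε φ (fun z => V z ω) l L E y} ≤ 1 / 4 * (L : ℝ) ^ (-2 * p)) →
      (∀ x y : Fin d → ℤ, 2 * (L : ℝ) < ‖x - y‖ →
        P.real {ω | ∃ E ∈ I,
          ¬ MSA.IsGood ρ ρ' ε φ (fun z => V z ω) (MSA.nextRate γ ρ ρ' α κ l) E L x ∧
          ¬ MSA.IsGood ρ ρ' ε φ (fun z => V z ω) (MSA.nextRate γ ρ ρ' α κ l) E L y} ≤
            (L : ℝ) ^ (-2 * p)) ∧
      0 < MSA.nextRate γ ρ ρ' α κ l ∧ MSA.nextRate γ ρ ρ' α κ l < κ ∧ κ ≤ κ₀ ∧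
      (l₁ ≤ l → MSA.minRate γ ρ ρ' α L ≤ MSA.nextRate γ ρ ρ' α κ l) := by
  have hα2 : α < 2 := by
    refine hα'.trans_le ?_
    have hd0 : (0:ℝ) ≤ d := Nat.cast_nonneg d
    rw [div_le_iff₀ (by linarith)]
    linarith
  have hp0 : 0 < p := lt_of_le_of_lt (by positivity) hp
  rcases le_or_gt α (5 / 4) with hα54 | hα54
  -- For such `α` the hypothesis `m(l) ≤ κ` cannot hold, so any thresholds of at least `1` will do.
  · refine ⟨1, one_pos, fun γ hγ => ⟨1, one_pos, ?_⟩⟩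
    intro κ₀ hκ₀ hκγ Ω _ P _ V φ ε I l L _ _ _ _ _ _ _ hl hmin
    exact absurd hmin (not_le.2 (MSA.lt_minRate_of_le hα54 hγ (hκ₀.trans hκγ)
      (by exact_mod_cast hl)))
  obtain ⟨N₀, hN₀⟩ := Filter.eventually_atTop.1
    ((MSA.eventually_largeScale (ρ := ρ) d κ ε₁ hρ' hα54 hα2).and
      (MSA.eventually_count_le hp0 (by linarith) hα'))
  refine ⟨N₀ + 1, by positivity, fun γ hγ => ?_⟩
  obtain ⟨N₁, hN₁⟩ := Filter.eventually_atTop.1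
    (MSA.eventually_minRate_le_nextRate (γ := γ) hρ' hρ hα54 hκ)
  refine ⟨N₁ + 1, by positivity, ?_⟩
  intro κ₀ hκ₀ hκγ Ω _ P _ V φ ε I l L hV hind _ hφ hε hε₁' hL hl hmin hP1 hP2
  have hlN : N₀ ≤ l := by
    have : (N₀ : ℝ) ≤ l := by linarith
    exact_mod_cast this
  obtain ⟨hS, hcount⟩ := hN₀ l hlN
  rw [← hL] at hS hcount
  have hlog : 0 < Real.log l := by linarith [hS.log_ge]
  refine ⟨?_, MSA.nextRate_pos hγ hlog hS.one_le hmin, MSA.nextRate_lt hγ hlog hS.one_le, hκ₀, ?_⟩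
  swap
  · intro hl₁
    rw [hL]
    refine hN₁ l ?_
    have : (N₁ : ℝ) ≤ l := by linarith
    exact_mod_cast this
  intro x y hxy
  have hfour : ∀ x, P.real {ω | (fun z => V z ω) ∈ MSA.fourBad ρ ρ' ε φ κ I l L x} ≤
      3 / 8 * (L : ℝ) ^ (-2 * p) := by
    intro x
    refine (MSA.measureReal_fourBad_le hV hind hφ ?_ x).trans hcount
    intro a b hab
    refine hP1 a b ?_
    rw [norm_sub_rev, MSA.norm_eq_supNorm]
    exact_mod_cast hab
  have hgood : ∀ (ω : Ω) (E : ℝ), E ∈ I → ∀ x,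
      ¬ MSA.IsGood ρ ρ' ε φ (fun z => V z ω) (MSA.nextRate γ ρ ρ' α κ l) E L x →
      ¬ MSA.HasResonance ρ' ε φ (fun z => V z ω) l L E x →
      (fun z => V z ω) ∈ MSA.fourBad ρ ρ' ε φ κ I l L x := by
    intro ω E hE x hbad hres
    by_contra hnot
    exact hbad (MSA.isGood_of_few_bad hρ' hρ hκ (by linarith) hφ hε hε₁' hS hmin hres
      fun h => hnot ⟨E, hE, h⟩)
  have hsub : {ω | ∃ E ∈ I,
      ¬ MSA.IsGood ρ ρ' ε φ (fun z => V z ω) (MSA.nextRate γ ρ ρ' α κ l) E L x ∧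
      ¬ MSA.IsGood ρ ρ' ε φ (fun z => V z ω) (MSA.nextRate γ ρ ρ' α κ l) E L y} ⊆
      {ω | ∃ E ∈ I, MSA.HasResonance ρ' ε φ (fun z => V z ω) l L E x ∧
        MSA.HasResonance ρ' ε φ (fun z => V z ω) l L E y} ∪
      ({ω | (fun z => V z ω) ∈ MSA.fourBad ρ ρ' ε φ κ I l L x} ∪
        {ω | (fun z => V z ω) ∈ MSA.fourBad ρ ρ' ε φ κ I l L y}) := by
    rintro ω ⟨E, hE, hx, hy⟩
    by_cases hrx : MSA.HasResonance ρ' ε φ (fun z => V z ω) l L E x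
    · by_cases hry : MSA.HasResonance ρ' ε φ (fun z => V z ω) l L E y
      · exact Or.inl ⟨E, hE, hrx, hry⟩
      · exact Or.inr (Or.inr (hgood ω E hE y hy hry))
    · exact Or.inr (Or.inl (hgood ω E hE x hx hrx))
  have h1 := MeasureTheory.measureReal_mono (μ := P) hsub (MeasureTheory.measure_ne_top P _)
  have h2 := h1.trans (MeasureTheory.measureReal_union_le _ _)
  have h3 := MeasureTheory.measureReal_union_le (μ := P)
    {ω | (fun z => V z ω) ∈ MSA.fourBad ρ ρ' ε φ κ I l L x}
    {ω | (fun z => V z ω) ∈ MSA.fourBad ρ ρ' ε φ κ I l L y}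
  have h4 := hP2 x y hxy
  have h5 := hfour x
  have h6 := hfour y
  linarith
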